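/- Let $\mathbb U=\bigcup_{n\ge 0}\{0,1\}^n$ be the set of finite words on $\{0,1\}$, $|u|$ the length of $u\in\mathbb U$. Let $(\mathbb T_t)_{t\ge 0}$ be the Yule tree process built from a family $(e_u)_{u\in\mathbb U}$ of i.i.d. $\mathbf{Exp}(1)$ lifetimes: at time $0$ the tree is reduced to the root $\emptyset$, and each node $u$, a lifetime $e_u$ after its birth, gets the two children $u0,u1$; $\mathbb T_t$ is the set of nodes born up to time $t$. Let $\partial \mathbb T_t$ be its set of leaves (nodes of $\mathbb T_t$ with no descendant in $\mathbb T_t$), $N_t=\#\partial\mathbb T_t$, $\tau_n=\inf\{t\ge 0: N_t=n+1\}$, and let $\mathcal T_n=\mathbb T_{\tau_n}$ be the embedded binary search tree process. For real $z>0$ put $$M(t,z)=\sum_{u\in\partial\mathbb T_t}z^{|u|}e^{t(1-2z)},\qquad \mathcal M_n(z)=\frac1{C_n(z)}\sum_{u\in\partial\mathcal T_n}z^{|u|},\qquad C_n(z)=\prod_{k=0}^{n-1}\frac{k+2z}{k+1},$$ and let $M'(t,z)$, $\mathcal M'_n(z)$ be the derivatives with respect to $z$. Let $$\xi=\lim_{t\to\infty}e^{-t}N_t,\qquad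 M'(\infty,1)=\lim_{t\to\infty}M'(t,1),\qquad \mathcal M'_\infty(1)=\lim_{n\to\infty}\mathcal M'_n(1).$$ For $i\in\{0,1\}$ let $\mathbb T^{(i)}_t=\{v\in\mathbb U: iv\in\mathbb T_{t+\tau^{(i)}}\}$, where $\tau^{(i)}=\inf\{t\ge 0:i\in\mathbb T_t\}$, be the tree process growing from the node $i$, let $\xi_i$ and $\mathcal M'_{\infty,(i)}(1)$ be the variables $\xi$ and $\mathcal M'_\infty(1)$ computed from $\mathbb T^{(i)}$ instead of $\mathbb T$, and let $U=\xi_0/(\xi_0+\xi_1)$. Then all these limits exist almost surely, $\xi\sim\mathbf{Exp}(1)$, and $$M'(\infty,1)=\xi\bigl(\mathcal M'_\infty(1)+2(\log\xi+\gamma-1)\bigr)\quad\text{a.s.},$$ where $\gamma$ is the Euler constant. Moreover $\mathcal M'_\infty(1)$ satisfies the almost sure Quicksort equation $$\mathcal M'_\infty(1)=U\mathcal M'_{\infty,(0)}(1)+(1-U)\mathcal M'_{\infty,(1)}(1)+2U\log U+2(1-U)\log(1-U)+1\quad\text{a.s.},$$ where $U$ is uniform on $[0,1]$, $\mathcal M'_{\infty,(0)}(1)$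 and $\mathcal M'_{\infty,(1)}(1)$ are distributed as $\mathcal M'_\infty(1)$, and $U$, $\mathcal M'_{\infty,(0)}(1)$, $\mathcal M'_{\infty,(1)}(1)$ are independent. -/

import Mathlib

open MeasureTheory ProbabilityTheory Filter Topology

noncomputable section

namespace YuleBST

/-- Finite words on the alphabet `{0, 1}`: `false` is the letter `0`, `true` is the letter `1`,
`[]` is the empty word and `u ++ v` is the concatenation `uv`. -/
abbrev Word : Type := List Bool

/-- The leaves of a tree: the nodes that have no (strict) descendant in the tree. -/
def leaves (T : Set Word) : Set Word :=
  {u | u ∈ T ∧ ∀ v : Word, v ≠ [] → u ++ v ∉ T}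

/-! ### The Yule tree process -/

/-- The time at which the node `u` is born, when each node `v` lives for a time `e v` and is then
replaced, as a leaf, by its two children: the sum of the lifetimes of the strict ancestors of `u`. -/
def birthTime (e : Word → ℝ) (u : Word) : ℝ :=
  ∑ k ∈ Finset.range u.length, e (u.take k)

/-- The tree at time `t`: the root is present from time `0` on, and each node gets its two children
at the end of its lifetime. -/
def yuleTree (e : Word → ℝ) (t : ℝ) : Set Word :=
  {u | birthTime e u ≤ t}

/-- The lifetimes of the nodes are independent random variables with distribution `Exp(1)`. -/
structure IsExpLifetimes {Ω : Type*} [MeasurableSpace Ω] (μ : Measure Ω) (e : Word → Ω → ℝ) :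
    Prop where
  measurable : ∀ u, Measurable (e u)
  law : ∀ u, HasLaw (e u) (expMeasure 1) μ
  indep : iIndepFun e μ

/-! ### Functionals of a tree-valued path `T : ℝ → Set Word`, time running through `[0, ∞)` -/

/-- The number `N_t` of leaves at time `t`. -/
def numLeaves (T : ℝ → Set Word) (t : ℝ) : ℕ :=
  (leaves (T t)).ncard

/-- The jump time `τ_n = inf {t | N_t = n + 1}`. -/
def jumpTime (T : ℝ → Set Word) (n : ℕ) : ℝ :=
  sInf {t : ℝ | 0 ≤ t ∧ numLeaves T t = n + 1}

/-- The embedded binary search tree with `n` internal nodes, `𝓣_n = T_{τ_n}`. -/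
def bst (T : ℝ → Set Word) (n : ℕ) : Set Word :=
  T (jumpTime T n)

/-- The time `τ^{(u)} = inf {t | u ∈ T_t}` at which the node `u` appears. -/
def appearTime (T : ℝ → Set Word) (u : Word) : ℝ :=
  sInf {t : ℝ | 0 ≤ t ∧ u ∈ T t}

/-- The tree process growing from the node `u`: `T^{(u)}_t = {v | uv ∈ T_{t + τ^{(u)}}}`. -/
def subtree (T : ℝ → Set Word) (u : Word) (t : ℝ) : Set Word :=
  {v | u ++ v ∈ T (t + appearTime T u)}

/-- `ξ = lim_{t → ∞} e^{-t} N_t`. -/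
def xi (T : ℝ → Set Word) : ℝ :=
  limUnder atTop (fun t : ℝ => Real.exp (-t) * numLeaves T t)

/-- `U = ξ₀ / (ξ₀ + ξ₁)`, where `ξ_i` is the limit `ξ` of the tree process growing from the
node `i`. -/
def U (T : ℝ → Set Word) : ℝ :=
  xi (subtree T [false]) / (xi (subtree T [false]) + xi (subtree T [true]))

/-- The level polynomial `∑_{u ∈ ∂T} z^{|u|}` of a (finite) tree. -/
def levelPoly (T : Set Word) (z : ℝ) : ℝ :=
  ∑ᶠ u ∈ leaves T, z ^ u.length

/-- The Yule martingale `M(t, z) = ∑_{u ∈ ∂T_t} z^{|u|} e^{t (1 - 2z)}`. -/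
def yuleM (T : ℝ → Set Word) (t z : ℝ) : ℝ :=
  levelPoly (T t) z * Real.exp (t * (1 - 2 * z))

/-- Its derivative `M'(t, z)` with respect to `z`. -/
def yuleM' (T : ℝ → Set Word) (t z : ℝ) : ℝ :=
  deriv (fun x : ℝ => yuleM T t x) z

/-- `M'(∞, z) = lim_{t → ∞} M'(t, z)`. -/
def yuleM'Lim (T : ℝ → Set Word) (z : ℝ) : ℝ :=
  limUnder atTop (fun t : ℝ => yuleM' T t z)

/-- `C_n(z) = ∏_{k < n} (k + 2z) / (k + 1)`. -/
def C (n : ℕ) (z : ℝ) : ℝ :=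
  ∏ k ∈ Finset.range n, ((k : ℝ) + 2 * z) / ((k : ℝ) + 1)

/-- The BST martingale `𝓜_n(z) = C_n(z)⁻¹ ∑_{u ∈ ∂𝓣_n} z^{|u|}`. -/
def bstM (T : ℝ → Set Word) (n : ℕ) (z : ℝ) : ℝ :=
  1 / C n z * levelPoly (bst T n) z

/-- Its derivative `𝓜'_n(z)` with respect to `z`. -/
def bstM' (T : ℝ → Set Word) (n : ℕ) (z : ℝ) : ℝ :=
  deriv (fun x : ℝ => bstM T n x) z

/-- `𝓜'_∞(z) = lim_n 𝓜'_n(z)`. -/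
def bstM'Lim (T : ℝ → Set Word) (z : ℝ) : ℝ :=
  limUnder atTop (fun n : ℕ => bstM' T n z)

end YuleBST

end

open YuleBST

section

open scoped ENNReal

/-! ### The canonical space of lifetimes -/

/-! The law of the lifetimes is self-similar: the root lifetime `r` and the environments `e⁰`, `e¹`
below its two children are independent, and both environments have the original law. The whole proof
takes place on this canonical space and works with recursions over the first generation.

The operator `branch F = e^{-r} (F(e⁰) + F(e¹))` preserves means, and on centred functions it
multiplies second moments by `2 E[e^{-2r}] = 2/3`. Equations `Y = B + branch Y` with `B` centred in
`L²` are therefore solved by a Neumann series (`exists_branch_fixedPoint`). This yields a candidate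
`W` for `ξ`, with `W = branch W`, and a candidate `Z` for `M'(∞,1)`, with `Z = (1-2r) e^{-r} (W(e⁰)
+ W(e¹)) + branch Z`; the weight `(1-2r) e^{-r}` is the derivative of `z e^{r(1-2z)}` at `z = 1`.
Beta-gamma algebra (`map_exp_mul_sum_ratio`) shows that `branch` preserves the law `Exp(1)`, so `W`
has law `Exp(1)`, and that `branch W` is independent of the uniform split ratio.

The deviations `e^{-t} N_t - W` and `M'(t,1) - Z` obey the same kind of recursion, which bounds
their second moments by a multiple of `e^{-t/2}`. They hence tend to zero almost surely along the
times `8 log (k+1)`. Both `N_t` and the external path length `P_t` are nondecreasing, so the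
convergence extends to all times (`ae_regularEnv`).

At `t = τ_n` one has `N_t = n + 1`, and `𝓜'_n(1) = P_t / (n+1) - 2 (H_{n+1} - 1)`. Since `log (n+1)
- τ_n → log W`, this converges to `Z/W - 2 (log W + γ - 1)`, called `bstLimit`, which is the stated
connection. Dividing the recursion of `Z` by that of `W` gives the Quicksort equation
(`bstLimit_eq`).

The joint law requires `W` to be independent of `Q = bstLimit` (`indepFun_bstLimit`). Unfolding the
Quicksort recursion `n` times from a constant gives variables `Q_n` that are independent of `W` by
induction, and `W (Q - Q_n)` is the `n`-th iterate of `branch` on a centred variable, hence tends to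
zero. -/

instance isProbabilityMeasure_expMeasure_one : IsProbabilityMeasure (expMeasure 1) :=
  isProbabilityMeasure_expMeasure one_pos

/-- An assignment of lifetimes to all words. -/
abbrev Env : Type := Word → ℝ

/-- The law of a family of independent `Exp(1)` lifetimes. -/
noncomputable def envMeasure : Measure Env := Measure.infinitePi (fun _ : Word => expMeasure 1)

instance : IsProbabilityMeasure envMeasure := by
  unfold envMeasure; infer_instance

/-- The lifetimes of the descendants of the child `i` of the root. -/
def Env.shift (i : Bool) (e : Env) : Env := fun v => e (i :: v)

/-- The root lifetime and the lifetimes below the two children of the root. -/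
def Env.split (e : Env) : ℝ × Env × Env := (e [], e.shift false, e.shift true)

/-- The inverse of `Env.split`. -/
def Env.join (x : ℝ × Env × Env) : Env
  | [] => x.1
  | false :: v => x.2.1 v
  | true :: v => x.2.2 v

@[fun_prop]
lemma Env.measurable_shift (i : Bool) : Measurable (Env.shift i) :=
  measurable_pi_lambda _ fun _ => measurable_pi_apply _

@[fun_prop]
lemma Env.measurable_split : Measurable Env.split :=
  (measurable_pi_apply _).prodMk ((Env.measurable_shift _).prodMk (Env.measurable_shift _))

lemma Env.measurable_join : Measurable Env.join := by
  refine measurable_pi_lambda _ fun u => ?_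
  rcases u with _ | ⟨_ | _, v⟩ <;> simp only [Env.join] <;> fun_prop

lemma Env.split_join (x : ℝ × Env × Env) : Env.split (Env.join x) = x := rfl

lemma prod_words_eq {M : Type*} [CommMonoid M] (s : Finset Word) (f : Word → M) :
    ∏ u ∈ s, f u = (if [] ∈ s then f [] else 1) *
      ((∏ v ∈ s.preimage (List.cons false) List.cons_injective.injOn, f (false :: v)) *
        ∏ v ∈ s.preimage (List.cons true) List.cons_injective.injOn, f (true :: v)) := by
  classical
  rw [Finset.prod_preimage' _ _ _ f, Finset.prod_preimage' _ _ _ f,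
    ← Finset.prod_ite_eq' s [] f, Finset.prod_filter, Finset.prod_filter,
    ← Finset.prod_mul_distrib, ← Finset.prod_mul_distrib]
  refine Finset.prod_congr rfl fun u _ => ?_
  rcases u with _ | ⟨_ | _, v⟩ <;> simp

/-- An infinite product measure is determined by finite boxes. The preimage of a box splits into one
factor for the root and one box for each first letter. -/
lemma map_join_eq :
    ((expMeasure 1).prod (envMeasure.prod envMeasure)).map Env.join = envMeasure := by
  classical
  refine Measure.eq_infinitePi _ fun s t ht => ?_
  rw [Measure.map_apply Env.measurable_join (.pi s.countable_toSet fun i _ => ht i)]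
  have h : Env.join ⁻¹' ((s : Set Word).pi t) =
      (if [] ∈ s then t [] else Set.univ) ×ˢ
      (((s.preimage (List.cons false) List.cons_injective.injOn : Finset Word) : Set Word).pi
          (fun v => t (false :: v)) ×ˢ
        ((s.preimage (List.cons true) List.cons_injective.injOn : Finset Word) : Set Word).pi
          (fun v => t (true :: v))) := by
    ext x
    simp only [Set.mem_preimage, Set.mem_pi, Set.mem_prod, Finset.coe_preimage, Finset.mem_coe]
    constructor
    · intro hx
      refine ⟨?_, fun v hv => hx _ hv, fun v hv => hx _ hv⟩
      split_ifs with h0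
      · exact hx _ h0
      · trivial
    · rintro ⟨h1, h2, h3⟩ u hu
      rcases u with _ | ⟨_ | _, v⟩
      · rw [if_pos hu] at h1; exact h1
      · exact h2 v hu
      · exact h3 v hu
  rw [h, Measure.prod_prod, Measure.prod_prod, prod_words_eq]
  congr 1
  · split_ifs <;> simp
  · rw [envMeasure, Measure.infinitePi_pi _ (fun i _ => ht _),
      Measure.infinitePi_pi _ (fun i _ => ht _)]

lemma measurePreserving_split :
    MeasurePreserving Env.split envMeasure ((expMeasure 1).prod (envMeasure.prod envMeasure)) := by
  refine ⟨Env.measurable_split, ?_⟩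
  conv_lhs => rw [← map_join_eq]
  rw [Measure.map_map Env.measurable_split Env.measurable_join]
  exact Measure.map_id

lemma measurePreserving_shift (i : Bool) :
    MeasurePreserving (Env.shift i) envMeasure envMeasure := by
  have h := measurePreserving_snd.comp measurePreserving_split
  cases i
  · exact measurePreserving_fst.comp h
  · exact measurePreserving_snd.comp h

lemma measurePreserving_eval (u : Word) :
    MeasurePreserving (fun e : Env => e u) envMeasure (expMeasure 1) :=
  measurePreserving_eval_infinitePi _ u

lemma ae_shift {p : Env → Prop} (h : ∀ᵐ e ∂envMeasure, p e) (i : Bool) :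
    ∀ᵐ e ∂envMeasure, p (e.shift i) :=
  (measurePreserving_shift i).quasiMeasurePreserving.ae h

/-- The lifetimes of the descendants of the node `u`. -/
def Env.shiftWord (u : Word) (e : Env) : Env := fun v => e (u ++ v)

lemma Env.shiftWord_cons (i : Bool) (u : Word) (e : Env) :
    e.shiftWord (i :: u) = (e.shift i).shiftWord u := rfl

/-- An almost sure property holds almost surely below every node. -/
lemma ae_shiftWord {p : Env → Prop} (h : ∀ᵐ e ∂envMeasure, p e) :
    ∀ᵐ e ∂envMeasure, ∀ u, p (e.shiftWord u) := by
  refine ae_all_iff.2 fun u => ?_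
  induction u with
  | nil => exact h
  | cons i u ih => exact ae_shift ih i

/-! ### Integrals against the exponential law -/

lemma expMeasure_eq : expMeasure 1 =
    (volume.restrict (Set.Ioi (0 : ℝ))).withDensity (fun x => ENNReal.ofReal (Real.exp (-x))) := by
  have h : expMeasure 1 = (volume : Measure ℝ).withDensity (exponentialPDF 1) := rfl
  rw [h, ← withDensity_indicator measurableSet_Ioi]
  refine withDensity_congr_ae ?_
  have h0 : ∀ᵐ x : ℝ, x ≠ 0 := by simp [ae_iff]
  filter_upwards [h0] with x hx
  rw [exponentialPDF_eq]
  by_cases h : 0 < x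
  · rw [Set.indicator_of_mem (Set.mem_Ioi.2 h), if_pos h.le]; simp
  · rw [Set.indicator_of_notMem (by simpa using h), if_neg]
    · simp
    · intro h'; exact h (lt_of_le_of_ne h' (Ne.symm hx))

lemma lintegral_expMeasure (f : ℝ → ℝ≥0∞) (hf : Measurable f) : ∫⁻ x, f x ∂(expMeasure 1) =
    ∫⁻ x in Set.Ioi (0 : ℝ), ENNReal.ofReal (Real.exp (-x)) * f x := by
  rw [expMeasure_eq, lintegral_withDensity_eq_lintegral_mul _ (by fun_prop) hf]
  rfl

lemma integral_expMeasure (f : ℝ → ℝ) : ∫ x, f x ∂(expMeasure 1) =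
    ∫ x in Set.Ioi (0 : ℝ), Real.exp (-x) * f x := by
  rw [expMeasure_eq, integral_withDensity_eq_integral_toReal_smul (by fun_prop) (by simp)]
  simp [Real.exp_nonneg]

lemma integrable_expMeasure_iff (f : ℝ → ℝ) : Integrable f (expMeasure 1) ↔
    IntegrableOn (fun x => Real.exp (-x) * f x) (Set.Ioi (0 : ℝ)) := by
  rw [expMeasure_eq, integrable_withDensity_iff_integrable_smul' (by fun_prop) (by simp)]
  simp [IntegrableOn, Real.exp_nonneg]

lemma ae_pos_expMeasure : ∀ᵐ x ∂(expMeasure 1), 0 < x := by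
  rw [expMeasure_eq]
  exact (withDensity_absolutelyContinuous _ _).ae_le (ae_restrict_mem measurableSet_Ioi)

lemma expMeasure_absolutelyContinuous : expMeasure 1 ≪ (volume : Measure ℝ) :=
  withDensity_absolutelyContinuous _ _

lemma ae_env_pos : ∀ᵐ e ∂envMeasure, ∀ u, 0 < e u :=
  ae_all_iff.2 fun u => (measurePreserving_eval u).quasiMeasurePreserving.ae ae_pos_expMeasure

/-! ### Beta-gamma algebra for two exponential variables -/

/-- The uniform law on `[0, 1]`. -/
noncomputable abbrev unifMeasure : Measure ℝ := volume.restrict (Set.Icc (0 : ℝ) 1)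

instance : IsProbabilityMeasure unifMeasure := ⟨by simp⟩

lemma lintegral_Ioo_scale {a : ℝ} (ha : 0 < a) (g : ℝ → ℝ≥0∞) (hg : Measurable g) :
    ∫⁻ x in Set.Ioo 0 a, g x = ENNReal.ofReal a * ∫⁻ u in Set.Ioo 0 1, g (a * u) := by
  rw [← lintegral_indicator measurableSet_Ioo, ← lintegral_indicator measurableSet_Ioo]
  conv_lhs => rw [← Real.smul_map_volume_mul_left ha.ne']
  rw [lintegral_smul_measure, lintegral_map (hg.indicator measurableSet_Ioo) (by fun_prop),
    abs_of_pos ha, smul_eq_mul]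
  congr 1
  refine lintegral_congr fun u => ?_
  have : (a * u ∈ Set.Ioo 0 a) ↔ u ∈ Set.Ioo (0 : ℝ) 1 := by
    simp only [Set.mem_Ioo, mul_pos_iff_of_pos_left ha]
    have : a * u < a ↔ u < 1 := by
      constructor <;> intro h <;> nlinarith
    rw [this]
  by_cases h : u ∈ Set.Ioo (0 : ℝ) 1
  · rw [Set.indicator_of_mem h, Set.indicator_of_mem (this.2 h)]
  · rw [Set.indicator_of_notMem h, Set.indicator_of_notMem (fun h' => h (this.1 h'))]

lemma lintegral_Ioi_translate (x : ℝ) (g : ℝ → ℝ≥0∞) :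
    ∫⁻ y in Set.Ioi 0, g (x + y) = ∫⁻ s in Set.Ioi x, g s := by
  rw [← lintegral_indicator measurableSet_Ioi, ← lintegral_indicator measurableSet_Ioi]
  conv_rhs => rw [← lintegral_add_left_eq_self _ x]
  refine lintegral_congr fun y => ?_
  simp [Set.indicator]

lemma lintegral_expMeasure_exp_neg (h : ℝ → ℝ≥0∞) (hh : Measurable h) :
    ∫⁻ r, h (Real.exp (-r)) ∂(expMeasure 1) = ∫⁻ v in Set.Ioo 0 1, h v := by
  rw [lintegral_expMeasure _ (by fun_prop)]
  have him : (fun r : ℝ => Real.exp (-r)) '' Set.Ioi 0 = Set.Ioo 0 1 := by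
    ext v
    constructor
    · rintro ⟨r, hr, rfl⟩
      exact ⟨Real.exp_pos _, by simpa using hr⟩
    · rintro ⟨h0, h1⟩
      exact ⟨-Real.log v, by simpa using Real.log_neg h0 h1, by simp [Real.exp_log h0]⟩
  rw [← him, lintegral_image_eq_lintegral_abs_deriv_mul (f' := fun r => -Real.exp (-r))
    measurableSet_Ioi]
  · simp [abs_of_pos (Real.exp_pos _)]
  · intro r _
    simpa using (hasDerivAt_neg r).exp.hasDerivWithinAt
  · intro a _ b _ hab
    simpa using hab

/-- Tonelli on the triangle `0 < x < s`. -/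
lemma setLIntegral_triangle_swap (F : ℝ → ℝ → ℝ≥0∞) (hF : Measurable (Function.uncurry F)) :
    ∫⁻ x in Set.Ioi (0 : ℝ), ∫⁻ s in Set.Ioi x, F x s =
      ∫⁻ s in Set.Ioi (0 : ℝ), ∫⁻ x in Set.Ioo 0 s, F x s := by
  have hS : MeasurableSet {p : ℝ × ℝ | 0 < p.1 ∧ p.1 < p.2} :=
    (measurableSet_lt measurable_const measurable_fst).inter
      (measurableSet_lt measurable_fst measurable_snd)
  have hm := hF.indicator hS
  have h1 : ∫⁻ x in Set.Ioi (0 : ℝ), ∫⁻ s in Set.Ioi x, F x s =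
      ∫⁻ x, ∫⁻ s, Set.indicator {p : ℝ × ℝ | 0 < p.1 ∧ p.1 < p.2} (Function.uncurry F) (x, s) := by
    rw [← lintegral_indicator measurableSet_Ioi]
    refine lintegral_congr fun x => ?_
    by_cases hx : 0 < x
    · rw [Set.indicator_of_mem (Set.mem_Ioi.2 hx), ← lintegral_indicator measurableSet_Ioi]
      refine lintegral_congr fun s => ?_
      simp [Set.indicator, hx]
    · rw [Set.indicator_of_notMem (by simpa using hx)]
      simp [Set.indicator, hx]
  have h2 : ∫⁻ s in Set.Ioi (0 : ℝ), ∫⁻ x in Set.Ioo 0 s, F x s =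
      ∫⁻ s, ∫⁻ x, Set.indicator {p : ℝ × ℝ | 0 < p.1 ∧ p.1 < p.2} (Function.uncurry F) (x, s) := by
    rw [← lintegral_indicator measurableSet_Ioi]
    refine lintegral_congr fun s => ?_
    by_cases hs : 0 < s
    · rw [Set.indicator_of_mem (Set.mem_Ioi.2 hs), ← lintegral_indicator measurableSet_Ioo]
      refine lintegral_congr fun x => ?_
      simp [Set.indicator]
    · rw [Set.indicator_of_notMem (by simpa using hs)]
      have : ∀ x, ¬ (0 < x ∧ x < s) := fun x h => hs (h.1.trans h.2)
      simp [Set.indicator, this]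
  rw [h1, h2]
  exact lintegral_lintegral_swap (hm.aemeasurable)

/-- This is the change of variables `s = x + y`, `u = x / s` with Jacobian `s`, carried out as a
translation in `y`, Tonelli, and a scaling in `x`. -/
lemma lintegral_exp_sum_ratio (g : ℝ → ℝ → ℝ≥0∞) (hg : Measurable (Function.uncurry g)) :
    ∫⁻ x, ∫⁻ y, g (x + y) (x / (x + y)) ∂(expMeasure 1) ∂(expMeasure 1) =
      ∫⁻ s in Set.Ioi 0, ENNReal.ofReal (Real.exp (-s)) * (ENNReal.ofReal s *
        ∫⁻ u in Set.Ioo 0 1, g s u) := by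
  have hg' : ∀ {α : Type} [MeasurableSpace α] (a b : α → ℝ), Measurable a → Measurable b →
    Measurable (fun z => g (a z) (b z)) := fun a b ha hb => hg.comp (ha.prodMk hb)
  rw [lintegral_expMeasure]
  swap
  · exact Measurable.lintegral_prod_right (hg' _ _ (by fun_prop) (by fun_prop))
  have h1 : ∀ x : ℝ, ENNReal.ofReal (Real.exp (-x)) *
      ∫⁻ y, g (x + y) (x / (x + y)) ∂(expMeasure 1) =
      ∫⁻ s in Set.Ioi x, ENNReal.ofReal (Real.exp (-s)) * g s (x / s) := by
    intro x
    have hm : Measurable fun y => g (x + y) (x / (x + y)) :=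
      hg' _ _ (by fun_prop) (by fun_prop)
    rw [lintegral_expMeasure _ hm, ← lintegral_const_mul _ (by fun_prop),
      ← lintegral_Ioi_translate x (fun s => ENNReal.ofReal (Real.exp (-s)) * g s (x / s))]
    refine lintegral_congr fun y => ?_
    rw [← mul_assoc, ← ENNReal.ofReal_mul (Real.exp_nonneg _), ← Real.exp_add, neg_add]
  simp_rw [h1]
  rw [setLIntegral_triangle_swap]
  swap
  · exact Measurable.mul (by fun_prop) (hg' _ _ (by fun_prop) (by fun_prop))
  refine setLIntegral_congr_fun measurableSet_Ioi fun s hs => ?_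
  have hs : 0 < s := hs
  rw [lintegral_const_mul _ (hg' _ _ (by fun_prop) (by fun_prop)),
    lintegral_Ioo_scale hs _ (hg' _ _ (by fun_prop) (by fun_prop))]
  simp_rw [mul_div_cancel_left₀ _ hs.ne']

lemma lintegral_exp_neg_Ioi (w : ℝ) :
    ∫⁻ s in Set.Ioi w, ENNReal.ofReal (Real.exp (-s)) = ENNReal.ofReal (Real.exp (-w)) := by
  rw [← ofReal_integral_eq_lintegral_ofReal (integrableOn_exp_neg_Ioi w)
    (ae_of_all _ fun _ => Real.exp_nonneg _), integral_exp_neg_Ioi]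

/-- If `E, X, Y` are independent `Exp(1)` variables then `exp (-E) (X + Y)` and `X / (X + Y)` are
independent, with laws `Exp(1)` and uniform. -/
lemma map_exp_mul_sum_ratio :
    ((expMeasure 1).prod ((expMeasure 1).prod (expMeasure 1))).map
      (fun p : ℝ × ℝ × ℝ => (Real.exp (-p.1) * (p.2.1 + p.2.2), p.2.1 / (p.2.1 + p.2.2))) =
    (expMeasure 1).prod unifMeasure := by
  refine Measure.ext_of_lintegral _ fun f hf => ?_
  have hf' : ∀ {α : Type} [MeasurableSpace α] (a b : α → ℝ), Measurable a → Measurable b →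
    Measurable (fun z => f (a z, b z)) := fun a b ha hb => hf.comp (ha.prodMk hb)
  rw [lintegral_map hf (by fun_prop), lintegral_prod _ (by
      exact (hf' _ _ (by fun_prop) (by fun_prop)).aemeasurable),
    lintegral_prod _ hf.aemeasurable]
  have hm2 : Measurable (fun p : ℝ × ℝ => ∫⁻ u in Set.Ioo 0 1, f (p.1 * p.2, u)) :=
    Measurable.lintegral_prod_right' (f := fun q : (ℝ × ℝ) × ℝ => f (q.1.1 * q.1.2, q.2))
      (hf' _ _ (by fun_prop) (by fun_prop))
  have hm3 : Measurable (fun p : ℝ × ℝ => ENNReal.ofReal (Real.exp (-p.2)) *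
      (ENNReal.ofReal p.2 * ∫⁻ u in Set.Ioo 0 1, f (p.1 * p.2, u))) := by fun_prop
  have hm4 : Measurable (fun w : ℝ => ∫⁻ u in Set.Ioo 0 1, f (w, u)) :=
    Measurable.lintegral_prod_right' hf
  let H : ℝ → ℝ≥0∞ := fun v => ∫⁻ s in Set.Ioi 0, ENNReal.ofReal (Real.exp (-s)) *
    (ENNReal.ofReal s * ∫⁻ u in Set.Ioo 0 1, f (v * s, u))
  have h1 : ∀ r : ℝ, ∫⁻ q : ℝ × ℝ, f (Real.exp (-r) * (q.1 + q.2), q.1 / (q.1 + q.2))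
      ∂((expMeasure 1).prod (expMeasure 1)) =
      H (Real.exp (-r)) := by
    intro r
    rw [lintegral_prod _ (by exact (hf' _ _ (by fun_prop) (by fun_prop)).aemeasurable)]
    exact lintegral_exp_sum_ratio (fun s u => f (Real.exp (-r) * s, u))
      (hf' _ _ (by fun_prop) (by fun_prop))
  rw [lintegral_congr h1]
  rw [lintegral_expMeasure_exp_neg H (Measurable.lintegral_prod_right' hm3),
    lintegral_lintegral_swap (hm3.aemeasurable)]
  -- The variable `v = e^{-E}` is uniform. Substituting `w = v s` absorbs the Gamma weight `s`, and
  -- integrating `e^{-s}` over `s > w` then leaves the exponential density `e^{-w}`.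
  have h2 : ∀ s ∈ Set.Ioi (0 : ℝ), ∫⁻ v in Set.Ioo 0 1, ENNReal.ofReal (Real.exp (-s)) *
      (ENNReal.ofReal s * ∫⁻ u in Set.Ioo 0 1, f (v * s, u)) =
      ∫⁻ w in Set.Ioo 0 s, ENNReal.ofReal (Real.exp (-s)) * ∫⁻ u in Set.Ioo 0 1, f (w, u) := by
    intro s hs
    have hmv : Measurable (fun v : ℝ => ∫⁻ u in Set.Ioo 0 1, f (v * s, u)) := by fun_prop
    rw [lintegral_const_mul _ (by fun_prop), lintegral_const_mul _ hmv,
      lintegral_const_mul _ hm4, lintegral_Ioo_scale hs _ hm4]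
    simp_rw [mul_comm s]
  rw [setLIntegral_congr_fun measurableSet_Ioi h2, ← setLIntegral_triangle_swap
    (fun w s => ENNReal.ofReal (Real.exp (-s)) * ∫⁻ u in Set.Ioo 0 1, f (w, u)) (by
      simp only [Function.uncurry_def]; fun_prop)]
  have h5 : ∀ w, ∫⁻ u, f (w, u) ∂unifMeasure = ∫⁻ u in Set.Ioo 0 1, f (w, u) := fun w => by
    rw [unifMeasure, restrict_Ioo_eq_restrict_Icc]
  simp only [h5]
  rw [lintegral_expMeasure _ hm4]
  refine lintegral_congr fun w => ?_
  rw [lintegral_mul_const _ (by fun_prop), lintegral_exp_neg_Ioi]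

/-! ### Second moments -/

/-- The second moment of `f`. -/
noncomputable def secondMoment {α : Type*} [MeasurableSpace α] (ν : Measure α) (f : α → ℝ) : ℝ≥0∞ :=
  ∫⁻ x, ENNReal.ofReal (f x ^ 2) ∂ν

section SecondMoment

variable {α : Type*} [MeasurableSpace α] {ν : Measure α}

lemma memLp_two_of_secondMoment {f : α → ℝ} (hf : AEStronglyMeasurable f ν)
    (h : secondMoment ν f < ∞) : MemLp f 2 ν := by
  rw [memLp_two_iff_integrable_sq hf]
  refine ⟨hf.pow 2, ?_⟩
  rw [hasFiniteIntegral_iff_ofReal (ae_of_all _ fun x => sq_nonneg _)]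
  exact h

lemma secondMoment_lt_top {f : α → ℝ} (hf : MemLp f 2 ν) : secondMoment ν f < ∞ := by
  have h := ((memLp_two_iff_integrable_sq hf.1).1 hf).2
  rwa [hasFiniteIntegral_iff_ofReal (ae_of_all _ fun x => sq_nonneg _)] at h

lemma secondMoment_eq {f : α → ℝ} (hf : MemLp f 2 ν) :
    secondMoment ν f = ENNReal.ofReal (∫ x, f x ^ 2 ∂ν) :=
  (ofReal_integral_eq_lintegral_ofReal ((memLp_two_iff_integrable_sq hf.1).1 hf)
    (ae_of_all _ fun _ => sq_nonneg _)).symm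

/-- The free weight `η` keeps the coefficient of `y²` close to one, so that adding an inhomogeneous
term `x` does not destroy a contraction acting on `y`. -/
lemma add_sq_le_weighted (x y : ℝ) {η : ℝ} (hη : 0 < η) :
    (x + y) ^ 2 ≤ (1 + η⁻¹) * x ^ 2 + (1 + η) * y ^ 2 := by
  have h : 0 ≤ η⁻¹ * (x - η * y) ^ 2 := by positivity
  have e : η⁻¹ * (x - η * y) ^ 2 = η⁻¹ * x ^ 2 - 2 * x * y + η * y ^ 2 := by
    field_simp; ring
  nlinarith

lemma secondMoment_add_le {f g : α → ℝ} (hf : Measurable f) (hg : Measurable g) {η : ℝ}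
    (hη : 0 < η) : secondMoment ν (fun x => f x + g x) ≤
      ENNReal.ofReal (1 + η⁻¹) * secondMoment ν f + ENNReal.ofReal (1 + η) * secondMoment ν g := by
  unfold secondMoment
  rw [← lintegral_const_mul _ (by fun_prop), ← lintegral_const_mul _ (by fun_prop),
    ← lintegral_add_left (by fun_prop)]
  refine lintegral_mono fun x => ?_
  simp only
  rw [← ENNReal.ofReal_mul (by positivity), ← ENNReal.ofReal_mul (by positivity),
    ← ENNReal.ofReal_add (by positivity) (by positivity)]
  exact ENNReal.ofReal_le_ofReal (add_sq_le_weighted _ _ hη)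

lemma secondMoment_const_mul {f : α → ℝ} (hf : Measurable f) (c : ℝ) :
    secondMoment ν (fun x => c * f x) = ENNReal.ofReal (c ^ 2) * secondMoment ν f := by
  unfold secondMoment
  rw [← lintegral_const_mul _ (by fun_prop)]
  refine lintegral_congr fun x => ?_
  rw [← ENNReal.ofReal_mul (by positivity), mul_pow]

/-- The second moment of a sum of two independent copies of a centred variable. -/
lemma secondMoment_add_copy [IsProbabilityMeasure ν] {f : α → ℝ} (hf : MemLp f 2 ν)
    (h0 : ∫ x, f x ∂ν = 0) :
    secondMoment (ν.prod ν) (fun p => f p.1 + f p.2) = 2 * secondMoment ν f := by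
  have h1 : MemLp (fun p : α × α => f p.1) 2 (ν.prod ν) :=
    hf.comp_measurePreserving measurePreserving_fst
  have h2 : MemLp (fun p : α × α => f p.2) 2 (ν.prod ν) :=
    hf.comp_measurePreserving measurePreserving_snd
  have hi1 := (memLp_two_iff_integrable_sq h1.1).1 h1
  have hi2 := (memLp_two_iff_integrable_sq h2.1).1 h2
  have hi3 : Integrable (fun p : α × α => f p.1 * f p.2) (ν.prod ν) := h1.integrable_mul h2
  have h12 : MemLp (fun p : α × α => f p.1 + f p.2) 2 (ν.prod ν) := h1.add h2
  rw [secondMoment_eq h12, secondMoment_eq hf, ← ENNReal.ofReal_ofNat,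
    ← ENNReal.ofReal_mul (by positivity)]
  congr 1
  have hexp : ∀ p : α × α, (f p.1 + f p.2) ^ 2 = f p.1 ^ 2 + 2 * (f p.1 * f p.2) + f p.2 ^ 2 :=
    fun p => by ring
  simp_rw [hexp]
  have hi4 : Integrable (fun p : α × α => f p.1 ^ 2 + 2 * (f p.1 * f p.2)) (ν.prod ν) :=
    hi1.add (hi3.const_mul 2)
  rw [integral_add hi4 hi2, integral_add hi1 (hi3.const_mul 2),
    integral_const_mul, integral_prod_mul f f, h0,
    integral_fun_fst (fun x => f x ^ 2), integral_fun_snd (fun x => f x ^ 2)]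
  simp
  ring

lemma ae_summable_of_tsum_lintegral {f : ℕ → α → ℝ} (hf : ∀ n, AEMeasurable (f n) ν)
    (h0 : ∀ n x, 0 ≤ f n x) {c : ℕ → ℝ} (hc : Summable c)
    (h : ∀ n, ∫⁻ x, ENNReal.ofReal (f n x) ∂ν ≤ ENNReal.ofReal (c n)) :
    ∀ᵐ x ∂ν, Summable fun n => f n x := by
  have hfin : ∫⁻ x, ∑' n, ENNReal.ofReal (f n x) ∂ν ≠ ∞ := by
    rw [lintegral_tsum (fun n => (hf n).ennreal_ofReal)]
    refine ne_top_of_le_ne_top ?_ (ENNReal.tsum_le_tsum h)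
    exact hc.tsum_ofReal_ne_top
  filter_upwards [ae_lt_top' (AEMeasurable.tsum fun n => (hf n).ennreal_ofReal) hfin] with x hx
  exact (ENNReal.summable_toReal hx.ne).congr fun n => ENNReal.toReal_ofReal (h0 n x)

lemma integral_sum_abs_le_of_secondMoment [IsProbabilityMeasure ν] {f : ℕ → α → ℝ}
    (hf : ∀ n, Measurable (f n)) {K : ℝ} (hK : 0 ≤ K)
    (h : ∀ n, secondMoment ν (f n) ≤ ENNReal.ofReal (K * (2 / 3) ^ n)) :
    (∀ᵐ x ∂ν, Summable fun n => |f n x|) ∧ Integrable (fun x => ∑' n, |f n x|) ν := by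
  have hc : Summable fun n : ℕ => (5 / 6 : ℝ) ^ n + K * (4 / 5) ^ n :=
    (summable_geometric_of_lt_one (by norm_num) (by norm_num)).add
      ((summable_geometric_of_lt_one (by norm_num) (by norm_num)).mul_left K)
  have hb : ∀ n, ∫⁻ x, ENNReal.ofReal |f n x| ∂ν ≤
      ENNReal.ofReal ((5 / 6 : ℝ) ^ n + K * (4 / 5) ^ n) := by
    intro n
    -- The inequality `|y| ≤ θ + y²/θ` is used with `θ = (5/6)^n`. Both resulting bounds are
    -- summable, because `(6/5)(2/3) = 4/5 < 1`.
    have hp : ∀ x, |f n x| ≤ (5 / 6 : ℝ) ^ n + (6 / 5) ^ n * f n x ^ 2 := by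
      intro x
      have h1 : (0 : ℝ) < (5 / 6) ^ n := by positivity
      have h2 : (6 / 5 : ℝ) ^ n = ((5 / 6) ^ n)⁻¹ := by rw [← inv_pow]; norm_num
      rw [h2]
      set θ : ℝ := (5 / 6) ^ n
      have h3 : 0 ≤ θ⁻¹ * (|f n x| - θ) ^ 2 := by positivity
      have h4 : θ⁻¹ * (|f n x| - θ) ^ 2 = θ⁻¹ * f n x ^ 2 - 2 * |f n x| + θ := by
        rw [← sq_abs (f n x)]; field_simp; ring
      nlinarith [abs_nonneg (f n x)]
    calc ∫⁻ x, ENNReal.ofReal |f n x| ∂ν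
        ≤ ∫⁻ x, (ENNReal.ofReal ((5 / 6 : ℝ) ^ n) +
            ENNReal.ofReal ((6 / 5) ^ n) * ENNReal.ofReal (f n x ^ 2)) ∂ν := by
          refine lintegral_mono fun x => ?_
          rw [← ENNReal.ofReal_mul (by positivity),
            ← ENNReal.ofReal_add (by positivity) (by positivity)]
          exact ENNReal.ofReal_le_ofReal (hp x)
      _ = ENNReal.ofReal ((5 / 6 : ℝ) ^ n) + ENNReal.ofReal ((6 / 5) ^ n) *
            secondMoment ν (f n) := by
          rw [lintegral_add_left (by fun_prop), lintegral_const_mul _ (by fun_prop)]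
          simp [secondMoment]
      _ ≤ ENNReal.ofReal ((5 / 6 : ℝ) ^ n) + ENNReal.ofReal ((6 / 5) ^ n) *
            ENNReal.ofReal (K * (2 / 3) ^ n) := by gcongr; exact h n
      _ = _ := by
          rw [← ENNReal.ofReal_mul (by positivity),
            ← ENNReal.ofReal_add (by positivity) (by positivity)]
          congr 2
          rw [mul_left_comm, ← mul_pow]; norm_num
  have hs := ae_summable_of_tsum_lintegral (fun n => (hf n).abs.aemeasurable) (fun n x => abs_nonneg _) hc hb
  refine ⟨hs, ?_⟩
  refine ⟨(Measurable.aestronglyMeasurable ?_), ?_⟩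
  · fun_prop
  rw [hasFiniteIntegral_iff_ofReal (ae_of_all _ fun x => tsum_nonneg fun n => abs_nonneg _)]
  calc ∫⁻ x, ENNReal.ofReal (∑' n, |f n x|) ∂ν
      = ∫⁻ x, ∑' n, ENNReal.ofReal |f n x| ∂ν := by
        refine lintegral_congr_ae ?_
        filter_upwards [hs] with x hx
        exact ENNReal.ofReal_tsum_of_nonneg (fun n => abs_nonneg _) hx
    _ = ∑' n, ∫⁻ x, ENNReal.ofReal |f n x| ∂ν := lintegral_tsum (fun n => by fun_prop)
    _ ≤ ∑' n, ENNReal.ofReal ((5 / 6 : ℝ) ^ n + K * (4 / 5) ^ n) := ENNReal.tsum_le_tsum hb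
    _ < ∞ := hc.tsum_ofReal_lt_top

end SecondMoment

/-! ### The branching operator -/

lemma lintegral_split (f : ℝ → Env × Env → ℝ≥0∞) (hf : Measurable (Function.uncurry f)) :
    ∫⁻ e, f (e []) (e.shift false, e.shift true) ∂envMeasure =
      ∫⁻ r, ∫⁻ p, f r p ∂(envMeasure.prod envMeasure) ∂(expMeasure 1) := by
  have h := lintegral_prod (μ := expMeasure 1) (ν := envMeasure.prod envMeasure) _ hf.aemeasurable
  rw [← measurePreserving_split.lintegral_comp hf] at h
  exact h

lemma Env.measurableEmbedding_split : MeasurableEmbedding Env.split := by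
  refine MeasurableEquiv.measurableEmbedding
    { toFun := Env.split
      invFun := Env.join
      left_inv := fun e => ?_
      right_inv := Env.split_join
      measurable_toFun := Env.measurable_split
      measurable_invFun := Env.measurable_join }
  funext u
  rcases u with _ | ⟨_ | _, v⟩ <;> rfl

lemma integral_split_mul {a : ℝ → ℝ} {F : Env × Env → ℝ} :
    ∫ e, a (e []) * F (e.shift false, e.shift true) ∂envMeasure =
      (∫ r, a r ∂(expMeasure 1)) * ∫ p, F p ∂(envMeasure.prod envMeasure) := by
  rw [← integral_prod_mul]
  rw [← measurePreserving_split.integral_comp Env.measurableEmbedding_split]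
  rfl

lemma integrable_split_mul {a : ℝ → ℝ} {F : Env × Env → ℝ} (ha : Integrable a (expMeasure 1))
    (hF : Integrable F (envMeasure.prod envMeasure)) :
    Integrable (fun e : Env => a (e []) * F (e.shift false, e.shift true)) envMeasure :=
  measurePreserving_split.integrable_comp_of_integrable (ha.mul_prod hF)

lemma integral_add_copy {F : Env → ℝ} (hF : Integrable F envMeasure) :
    ∫ p : Env × Env, F p.1 + F p.2 ∂(envMeasure.prod envMeasure) = 2 * ∫ e, F e ∂envMeasure := by
  rw [integral_add (hF.comp_fst _) (hF.comp_snd _), integral_fun_fst, integral_fun_snd]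
  simp; ring

lemma integrable_add_copy {F : Env → ℝ} (hF : Integrable F envMeasure) :
    Integrable (fun p : Env × Env => F p.1 + F p.2) (envMeasure.prod envMeasure) :=
  (hF.comp_fst _).add (hF.comp_snd _)

/-- `a(e_∅) (F(e⁰) + F(e¹))`: the sum over the two subtrees with a root-dependent weight. -/
noncomputable def weightedBranch (a : ℝ → ℝ) (F : Env → ℝ) (e : Env) : ℝ :=
  a (e []) * (F (e.shift false) + F (e.shift true))

@[fun_prop]
lemma measurable_weightedBranch {a : ℝ → ℝ} (ha : Measurable a) {F : Env → ℝ} (hF : Measurable F) :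
    Measurable (weightedBranch a F) := by
  unfold weightedBranch
  exact (ha.comp (measurable_pi_apply _)).mul
    ((hF.comp (Env.measurable_shift _)).add (hF.comp (Env.measurable_shift _)))

lemma integrable_weightedBranch {a : ℝ → ℝ} (ha : Integrable a (expMeasure 1)) {F : Env → ℝ}
    (hF : Integrable F envMeasure) : Integrable (weightedBranch a F) envMeasure :=
  integrable_split_mul ha (integrable_add_copy hF)

lemma integral_weightedBranch {a : ℝ → ℝ} {F : Env → ℝ} (hF : Integrable F envMeasure) :
    ∫ e, weightedBranch a F e ∂envMeasure =
      (∫ r, a r ∂(expMeasure 1)) * (2 * ∫ e, F e ∂envMeasure) := by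
  rw [← integral_add_copy hF]
  exact integral_split_mul (a := a) (F := fun p => F p.1 + F p.2)

lemma secondMoment_weightedBranch_eq {a : ℝ → ℝ} (ha : Measurable a) {F : Env → ℝ}
    (hF : Measurable F) : secondMoment envMeasure (weightedBranch a F) =
      secondMoment (expMeasure 1) a *
        secondMoment (envMeasure.prod envMeasure) (fun p => F p.1 + F p.2) := by
  have h := lintegral_split (fun r p => ENNReal.ofReal ((a r * (F p.1 + F p.2)) ^ 2))
    (by simp only [Function.uncurry_def]; fun_prop)
  unfold secondMoment weightedBranch
  simp only at h
  rw [h, ← lintegral_mul_const _ (by fun_prop)]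
  refine lintegral_congr fun r => ?_
  rw [← lintegral_const_mul _ (by fun_prop)]
  refine lintegral_congr fun p => ?_
  rw [mul_pow, ENNReal.ofReal_mul (by positivity)]

lemma secondMoment_weightedBranch_of_centred {a : ℝ → ℝ} (ha : Measurable a) {F : Env → ℝ}
    (hF : Measurable F) (hL : MemLp F 2 envMeasure) (h0 : ∫ e, F e ∂envMeasure = 0) :
    secondMoment envMeasure (weightedBranch a F) =
      secondMoment (expMeasure 1) a * (2 * secondMoment envMeasure F) := by
  rw [secondMoment_weightedBranch_eq ha hF, secondMoment_add_copy hL h0]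

/-- `e^{-e_∅} (F(e⁰) + F(e¹))`. -/
noncomputable abbrev branch : (Env → ℝ) → Env → ℝ := weightedBranch fun r => Real.exp (-r)

lemma integral_exp_neg_mul_Ioi {c : ℝ} (hc : 0 < c) (t : ℝ) :
    ∫ r in Set.Ioi t, Real.exp (-(c * r)) = Real.exp (-(c * t)) / c := by
  have := integral_exp_mul_Ioi (a := -c) (by linarith) t
  simp only [neg_mul] at this
  rw [this, neg_div_neg_eq]

lemma integrableOn_exp_neg_mul_Ioi {c : ℝ} (hc : 0 < c) (t : ℝ) :
    IntegrableOn (fun r => Real.exp (-(c * r))) (Set.Ioi t) := by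
  simpa only [neg_mul] using integrableOn_exp_mul_Ioi (a := -c) (by linarith) t

lemma integral_exp_neg_expMeasure : ∫ r, Real.exp (-r) ∂(expMeasure 1) = 1 / 2 := by
  rw [integral_expMeasure]
  have h := integral_exp_neg_mul_Ioi (c := 2) two_pos 0
  simp only [mul_zero, neg_zero, Real.exp_zero] at h
  rw [← h]
  congr 1 with r
  rw [← Real.exp_add]; ring_nf

lemma integrable_exp_neg_expMeasure : Integrable (fun r => Real.exp (-r)) (expMeasure 1) := by
  rw [integrable_expMeasure_iff]
  refine (integrableOn_exp_neg_mul_Ioi (c := 2) two_pos 0).congr_fun (fun r _ => ?_)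
    measurableSet_Ioi
  simp only [← Real.exp_add]; ring_nf

lemma secondMoment_exp_neg : secondMoment (expMeasure 1) (fun r => Real.exp (-r)) =
    ENNReal.ofReal (1 / 3) := by
  have h := integral_exp_neg_mul_Ioi (c := 3) (by norm_num) 0
  simp only [mul_zero, neg_zero, Real.exp_zero] at h
  rw [secondMoment, lintegral_expMeasure _ (by fun_prop), ← h,
    ofReal_integral_eq_lintegral_ofReal (integrableOn_exp_neg_mul_Ioi (by norm_num) 0)
      (ae_of_all _ fun _ => Real.exp_nonneg _)]
  refine lintegral_congr fun r => ?_
  rw [← ENNReal.ofReal_mul (Real.exp_nonneg _), sq, ← Real.exp_add, ← Real.exp_add]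
  ring_nf

lemma integrable_branch {F : Env → ℝ} (hF : Integrable F envMeasure) :
    Integrable (branch F) envMeasure :=
  integrable_weightedBranch integrable_exp_neg_expMeasure hF

lemma integral_branch {F : Env → ℝ} (hF : Integrable F envMeasure) :
    ∫ e, branch F e ∂envMeasure = ∫ e, F e ∂envMeasure := by
  rw [branch, integral_weightedBranch hF, integral_exp_neg_expMeasure]; ring

lemma memLp_branch {F : Env → ℝ} (hF : Measurable F) (hL : MemLp F 2 envMeasure) :
    MemLp (branch F) 2 envMeasure := by
  refine memLp_two_of_secondMoment (by fun_prop) ?_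
  rw [branch, secondMoment_weightedBranch_eq (by fun_prop) hF, secondMoment_exp_neg]
  refine ENNReal.mul_lt_top ENNReal.ofReal_lt_top (secondMoment_lt_top ?_)
  exact (hL.comp_measurePreserving measurePreserving_fst).add
    (hL.comp_measurePreserving measurePreserving_snd)

/-- The root is independent of the two subtrees and the cross term of two centred independent copies
vanishes, so the factor is `2 E[e^{-2r}] = 2 · (1/3)`. This contraction drives the whole argument.
-/
lemma secondMoment_branch {F : Env → ℝ} (hF : Measurable F) (hL : MemLp F 2 envMeasure)
    (h0 : ∫ e, F e ∂envMeasure = 0) :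
    secondMoment envMeasure (branch F) = ENNReal.ofReal (2 / 3) * secondMoment envMeasure F := by
  rw [branch, secondMoment_weightedBranch_of_centred (by fun_prop) hF hL h0, secondMoment_exp_neg,
    ← mul_assoc, ← ENNReal.ofReal_ofNat, ← ENNReal.ofReal_mul (by norm_num)]
  norm_num

lemma iterate_branch {F : Env → ℝ} (hF : Measurable F) (hL : MemLp F 2 envMeasure)
    (h0 : ∫ e, F e ∂envMeasure = 0) (n : ℕ) :
    Measurable (branch^[n] F) ∧ MemLp (branch^[n] F) 2 envMeasure ∧
      ∫ e, branch^[n] F e ∂envMeasure = 0 ∧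
      secondMoment envMeasure (branch^[n] F) =
        ENNReal.ofReal ((2 / 3) ^ n) * secondMoment envMeasure F := by
  induction n with
  | zero => simpa using ⟨hF, hL, h0⟩
  | succ n ih =>
    obtain ⟨h1, h2, h3, h4⟩ := ih
    rw [Function.iterate_succ_apply']
    refine ⟨by fun_prop, memLp_branch h1 h2, ?_, ?_⟩
    · rw [integral_branch (h2.integrable (by norm_num)), h3]
    · rw [secondMoment_branch h1 h2 h3, h4, ← mul_assoc, ← ENNReal.ofReal_mul (by norm_num),
        pow_succ']

lemma iterate_branch_summable {F : Env → ℝ} (hF : Measurable F) (hL : MemLp F 2 envMeasure)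
    (h0 : ∫ e, F e ∂envMeasure = 0) :
    (∀ᵐ e ∂envMeasure, Summable fun n => |branch^[n] F e|) ∧
      Integrable (fun e => ∑' n, |branch^[n] F e|) envMeasure := by
  refine integral_sum_abs_le_of_secondMoment (K := (secondMoment envMeasure F).toReal)
    (fun n => (iterate_branch hF hL h0 n).1) ENNReal.toReal_nonneg fun n => ?_
  rw [(iterate_branch hF hL h0 n).2.2.2, ENNReal.ofReal_mul ENNReal.toReal_nonneg,
    ENNReal.ofReal_toReal (secondMoment_lt_top hL).ne, mul_comm]

/-! ### Fixed points of the branching operator -/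

lemma branch_apply (F : Env → ℝ) (e : Env) :
    branch F e = Real.exp (-e []) * (F (e.shift false) + F (e.shift true)) := rfl

lemma branch_sum_range (F : ℕ → Env → ℝ) (n : ℕ) :
    branch (fun e => ∑ k ∈ Finset.range n, F k e) =
      fun e => ∑ k ∈ Finset.range n, branch (F k) e := by
  funext e
  simp only [branch_apply, ← Finset.mul_sum, Finset.sum_add_distrib]

lemma sum_iterate_branch_succ (B : Env → ℝ) (n : ℕ) (e : Env) :
    ∑ k ∈ Finset.range (n + 1), branch^[k] B e =
      B e + branch (fun e => ∑ k ∈ Finset.range n, branch^[k] B e) e := by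
  rw [Finset.sum_range_succ', branch_sum_range, add_comm]
  simp only [Function.iterate_succ_apply', Function.iterate_zero_apply]

/-- Fatou's lemma for second moments. -/
lemma lintegral_le_of_ae_tendsto {α : Type*} [MeasurableSpace α] {ν : Measure α} {f : ℕ → α → ℝ}
    {g : α → ℝ} (hf : ∀ n, Measurable (f n))
    (h : ∀ᵐ x ∂ν, Tendsto (fun n => f n x) atTop (𝓝 (g x))) {C : ℝ≥0∞}
    (hC : ∀ n, secondMoment ν (f n) ≤ C) : secondMoment ν g ≤ C := by
  have h1 : secondMoment ν g ≤ ∫⁻ x, liminf (fun n => ENNReal.ofReal (f n x ^ 2)) atTop ∂ν := by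
    refine lintegral_mono_ae ?_
    filter_upwards [h] with x hx
    have : Tendsto (fun n => ENNReal.ofReal (f n x ^ 2)) atTop (𝓝 (ENNReal.ofReal (g x ^ 2))) :=
      (ENNReal.continuous_ofReal.tendsto _).comp (hx.pow 2)
    rw [this.liminf_eq]
  refine h1.trans ((lintegral_liminf_le fun n => by fun_prop).trans ?_)
  refine (liminf_le_liminf (v := fun _ => C) (Eventually.of_forall fun n => hC n)).trans ?_
  simp

/-- The solution is the Neumann series `∑ branch^k B`. It converges absolutely almost surely, since
the second moments of its terms decay like `(2/3)^k`. -/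
theorem exists_branch_fixedPoint {B : Env → ℝ} (hB : Measurable B) (hL : MemLp B 2 envMeasure)
    (h0 : ∫ e, B e ∂envMeasure = 0) :
    ∃ Y : Env → ℝ, Measurable Y ∧ MemLp Y 2 envMeasure ∧ ∫ e, Y e ∂envMeasure = 0 ∧
      (∀ᵐ e ∂envMeasure,
        Tendsto (fun n => ∑ k ∈ Finset.range n, branch^[k] B e) atTop (𝓝 (Y e))) ∧
      ∀ᵐ e ∂envMeasure, Y e = B e + branch Y e := by
  have hit := iterate_branch hB hL h0
  obtain ⟨hs, hint⟩ := iterate_branch_summable hB hL h0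
  have hmeas : ∀ n, Measurable fun e => ∑ k ∈ Finset.range n, branch^[k] B e := fun n =>
    Finset.measurable_sum _ fun k _ => (hit k).1
  obtain ⟨Y, hY, hlim⟩ := measurable_limit_of_tendsto_metrizable_ae
    (fun n => (hmeas n).aemeasurable) (by
      filter_upwards [hs] with e he
      exact ⟨_, (he.of_abs).hasSum.tendsto_sum_nat⟩ :
      ∀ᵐ e ∂envMeasure, ∃ l, Tendsto (fun n => ∑ k ∈ Finset.range n, branch^[k] B e) atTop (𝓝 l))
  have hLn : ∀ n, MemLp (fun e => ∑ k ∈ Finset.range n, branch^[k] B e) 2 envMeasure := fun n =>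
    memLp_finsetSum _ fun k _ => (hit k).2.1
  have h0n : ∀ n, ∫ e, ∑ k ∈ Finset.range n, branch^[k] B e ∂envMeasure = 0 := fun n => by
    rw [integral_finsetSum _ fun k _ => (hit k).2.1.integrable (by norm_num)]
    exact Finset.sum_eq_zero fun k _ => (hit k).2.2.1
  -- The constant `30` is stable under `S_{n+1} = B + branch S_n` with `η = 1/4`: `5 + (5/4)(2/3) ·
  -- 30 = 30`.
  have hbd : ∀ n, secondMoment envMeasure (fun e => ∑ k ∈ Finset.range n, branch^[k] B e) ≤
      ENNReal.ofReal 30 * secondMoment envMeasure B := by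
    intro n
    induction n with
    | zero => simp [secondMoment]
    | succ n ih =>
      have hm := hmeas n
      rw [show (fun e => ∑ k ∈ Finset.range (n + 1), branch^[k] B e) = fun e =>
        B e + branch (fun e => ∑ k ∈ Finset.range n, branch^[k] B e) e from
          funext (sum_iterate_branch_succ B n)]
      refine (secondMoment_add_le (η := 1 / 4) hB (by fun_prop) (by norm_num)).trans ?_
      rw [secondMoment_branch hm (hLn n) (h0n n)]
      calc _ ≤ ENNReal.ofReal (1 + (1 / 4)⁻¹) * secondMoment envMeasure B +
            ENNReal.ofReal (1 + 1 / 4) * (ENNReal.ofReal (2 / 3) *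
              (ENNReal.ofReal 30 * secondMoment envMeasure B)) := by gcongr
        _ = ENNReal.ofReal 30 * secondMoment envMeasure B := by
          rw [← mul_assoc, ← mul_assoc, ← ENNReal.ofReal_mul (by norm_num),
            ← ENNReal.ofReal_mul (by norm_num), ← add_mul,
            ← ENNReal.ofReal_add (by norm_num) (by norm_num)]
          norm_num
  refine ⟨Y, hY, memLp_two_of_secondMoment hY.aestronglyMeasurable
    ((lintegral_le_of_ae_tendsto hmeas hlim hbd).trans_lt
      (ENNReal.mul_lt_top ENNReal.ofReal_lt_top (secondMoment_lt_top hL))), ?_, hlim, ?_⟩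
  · have := tendsto_integral_of_dominated_convergence _ (fun n => (hmeas n).aestronglyMeasurable)
      hint (fun n => ?_) hlim
    · simp only [h0n] at this
      exact (tendsto_nhds_unique tendsto_const_nhds this).symm
    · filter_upwards [hs] with e he
      refine (Finset.abs_sum_le_sum_abs _ _).trans ?_
      exact he.sum_le_tsum _ (fun k _ => abs_nonneg _)
  · filter_upwards [hlim, ae_shift hlim false, ae_shift hlim true] with e h1 h2 h3
    refine tendsto_nhds_unique ((tendsto_add_atTop_iff_nat 1).2 h1) ?_
    simp only [sum_iterate_branch_succ, branch_apply]
    exact ((h2.add h3).const_mul _).const_add _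

/-! ### Moments of the exponential law -/

lemma integrable_pow_expMeasure (n : ℕ) : Integrable (fun x => x ^ n) (expMeasure 1) := by
  rw [integrable_expMeasure_iff]
  have h := Real.GammaIntegral_convergent (s := n + 1) (by positivity)
  refine h.congr_fun (fun x _ => ?_) measurableSet_Ioi
  simp

lemma integral_id_expMeasure : ∫ x, x ∂(expMeasure 1) = 1 := by
  rw [integral_expMeasure]
  have h := Real.Gamma_eq_integral (s := 2) (by norm_num)
  rw [Real.Gamma_two] at h
  rw [h]
  refine setIntegral_congr_fun measurableSet_Ioi fun x _ => ?_
  norm_num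

lemma memLp_id_expMeasure : MemLp (fun x : ℝ => x) 2 (expMeasure 1) :=
  (memLp_two_iff_integrable_sq (by fun_prop)).2 (integrable_pow_expMeasure 2)

lemma memLp_mul_log_expMeasure : MemLp (fun x : ℝ => x * Real.log x) 2 (expMeasure 1) := by
  have h2 : MemLp (fun x : ℝ => 1 + x ^ 2) 2 (expMeasure 1) := by
    have h3 : MemLp (fun x : ℝ => x ^ 2) 2 (expMeasure 1) := by
      rw [memLp_two_iff_integrable_sq (by fun_prop)]
      simpa only [← pow_mul] using integrable_pow_expMeasure (2 * 2)
    have h4 : MemLp (fun _ : ℝ => (1 : ℝ)) 2 (expMeasure 1) := memLp_const _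
    exact h4.add h3
  refine h2.mono' (by fun_prop) ?_
  filter_upwards [ae_pos_expMeasure] with x hx
  rw [Real.norm_eq_abs]
  rcases le_or_gt x 1 with h | h
  · have := Real.abs_log_mul_self_lt x hx h
    rw [mul_comm]; nlinarith [sq_nonneg x]
  · rw [abs_of_nonneg (mul_nonneg hx.le (Real.log_nonneg h.le))]
    nlinarith [Real.log_le_sub_one_of_pos hx]

lemma memLp_comp_of_map_eq {F : Env → ℝ} (hF : Measurable F)
    (h : envMeasure.map F = expMeasure 1) {g : ℝ → ℝ} (hg : MemLp g 2 (expMeasure 1)) :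
    MemLp (fun e => g (F e)) 2 envMeasure :=
  hg.comp_measurePreserving ⟨hF, h⟩

/-! ### The limit of the normalised population -/

lemma map_split_pair {β : Type*} [MeasurableSpace β] {F : Env → β} (hF : Measurable F) :
    envMeasure.map (fun e => (e [], F (e.shift false), F (e.shift true))) =
      (expMeasure 1).prod ((envMeasure.map F).prod (envMeasure.map F)) := by
  have : IsProbabilityMeasure (envMeasure.map F) := Measure.isProbabilityMeasure_map hF.aemeasurable
  rw [Measure.map_prod_map _ _ hF hF]
  conv_rhs => rw [← Measure.map_id (μ := expMeasure 1)]
  rw [Measure.map_prod_map _ _ measurable_id (hF.prodMap hF), ← measurePreserving_split.map_eq,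
    Measure.map_map (by fun_prop) Env.measurable_split]
  rfl

/-- If `F` is `Exp(1)` distributed then `branch F` is `Exp(1)` distributed and independent of the
uniform variable `F(e⁰) / (F(e⁰) + F(e¹))`. -/
lemma map_branch_ratio {F : Env → ℝ} (hF : Measurable F) (h : envMeasure.map F = expMeasure 1) :
    envMeasure.map
      (fun e => (branch F e, F (e.shift false) / (F (e.shift false) + F (e.shift true)))) =
      (expMeasure 1).prod unifMeasure := by
  have h1 := map_split_pair hF
  rw [h] at h1
  rw [← map_exp_mul_sum_ratio, ← h1, Measure.map_map (by fun_prop) (by fun_prop)]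
  rfl

lemma map_branch {F : Env → ℝ} (hF : Measurable F) (h : envMeasure.map F = expMeasure 1) :
    envMeasure.map (branch F) = expMeasure 1 := by
  have h1 := congrArg (Measure.map Prod.fst) (map_branch_ratio hF h)
  rw [Measure.map_map (by fun_prop) (by fun_prop), Measure.map_fst_prod] at h1
  simpa [Function.comp_def] using h1

lemma map_iterate_branch (n : ℕ) :
    Measurable (branch^[n] fun e => e []) ∧
      envMeasure.map (branch^[n] fun e => e []) = expMeasure 1 := by
  induction n with
  | zero => exact ⟨measurable_pi_apply _, (measurePreserving_eval []).map_eq⟩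
  | succ n ih =>
    rw [Function.iterate_succ_apply']
    exact ⟨by have := ih.1; fun_prop, map_branch ih.1 ih.2⟩

/-- Almost sure convergence implies convergence of integrals of bounded continuous functions, and
these determine a law. -/
lemma map_eq_of_ae_tendsto {α : Type*} [MeasurableSpace α] {ν : Measure α} [IsProbabilityMeasure ν]
    {f : ℕ → α → ℝ} {g : α → ℝ} (hf : ∀ n, Measurable (f n)) (hg : Measurable g)
    (h : ∀ᵐ x ∂ν, Tendsto (fun n => f n x) atTop (𝓝 (g x))) {ρ : Measure ℝ}
    [IsProbabilityMeasure ρ] (hρ : ∀ n, ν.map (f n) = ρ) : ν.map g = ρ := by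
  have : IsProbabilityMeasure (ν.map g) := Measure.isProbabilityMeasure_map hg.aemeasurable
  refine ext_of_forall_integral_eq_of_IsFiniteMeasure fun φ => ?_
  rw [integral_map hg.aemeasurable φ.continuous.aestronglyMeasurable]
  have h1 : Tendsto (fun n => ∫ x, φ (f n x) ∂ν) atTop (𝓝 (∫ x, φ (g x) ∂ν)) := by
    refine tendsto_integral_of_dominated_convergence (fun _ => ‖φ‖)
      (fun n => (φ.continuous.measurable.comp (hf n)).aestronglyMeasurable) (integrable_const _)
      (fun n => ae_of_all _ fun x => φ.norm_coe_le_norm _) ?_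
    filter_upwards [h] with x hx
    exact (φ.continuous.tendsto _).comp hx
  have h2 : ∀ n, ∫ x, φ (f n x) ∂ν = ∫ y, φ y ∂ρ := fun n => by
    rw [← hρ n, integral_map (hf n).aemeasurable φ.continuous.aestronglyMeasurable]
  simp only [h2] at h1
  exact (tendsto_nhds_unique tendsto_const_nhds h1).symm

/-- The iterates `branch^n X` of the root lifetime `X` all have law `Exp(1)`. Their increments are
the iterates of the centred variable `branch X - X`, so they converge almost surely; the limit
inherits the law and is a fixed point. -/
theorem exists_population_limit : ∃ W : Env → ℝ, Measurable W ∧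
    envMeasure.map W = expMeasure 1 ∧ ∀ᵐ e ∂envMeasure, W e = branch W e := by
  let X : Env → ℝ := fun e => e []
  have hX : Measurable X := measurable_pi_apply _
  have hXmap : envMeasure.map X = expMeasure 1 := (measurePreserving_eval []).map_eq
  have hXL : MemLp X 2 envMeasure := memLp_comp_of_map_eq hX hXmap memLp_id_expMeasure
  have hXi : Integrable X envMeasure := hXL.integrable (by norm_num)
  obtain ⟨Y, hY, hYL, hY0, hlim, hfix⟩ := exists_branch_fixedPoint
    (B := fun e => branch X e - X e) (by fun_prop) ((memLp_branch hX hXL).sub hXL) (by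
      rw [integral_sub (integrable_branch hXi) hXi, integral_branch hXi, sub_self])
  have hit : ∀ k, branch^[k] (fun e => branch X e - X e) =
      fun e => branch^[k + 1] X e - branch^[k] X e := by
    intro k
    induction k with
    | zero => rfl
    | succ k ih =>
      rw [Function.iterate_succ_apply', ih]
      funext e
      rw [Function.iterate_succ_apply' _ (k + 1), Function.iterate_succ_apply' _ k]
      simp only [branch_apply]; ring
  have hsum : ∀ n e, ∑ k ∈ Finset.range n, branch^[k] (fun e => branch X e - X e) e =
      branch^[n] X e - X e := by
    intro n e
    simp only [hit]
    exact Finset.sum_range_sub (fun k => branch^[k] X e) n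
  refine ⟨fun e => X e + Y e, by fun_prop, ?_, ?_⟩
  · refine map_eq_of_ae_tendsto (f := fun n => branch^[n] X) (fun n => (map_iterate_branch n).1)
      (by fun_prop) ?_ (fun n => (map_iterate_branch n).2)
    filter_upwards [hlim] with e he
    simp only [hsum] at he
    simpa using he.const_add (X e)
  · filter_upwards [hfix] with e he
    rw [he]
    simp only [branch_apply]; ring

/-! ### The limit of the derivative martingale -/

/-- The weight `(1-2r) e^{-r}` times the exponential density has the primitive `r e^{-2r}`, which
vanishes at `0` and at infinity. Hence the source term of `Z` is centred. -/
lemma hasDerivAt_mul_exp_neg_two (r : ℝ) :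
    HasDerivAt (fun r => r * Real.exp (-(2 * r))) (Real.exp (-r) * ((1 - 2 * r) * Real.exp (-r)))
      r := by
  have h := (hasDerivAt_id r).mul (((hasDerivAt_id r).const_mul 2).neg.exp)
  refine h.congr_deriv ?_
  have : Real.exp (-r) * Real.exp (-r) = Real.exp (-(2 * r)) := by rw [← Real.exp_add]; ring_nf
  simp only [id]
  linear_combination (-1 + 2 * r) * this

lemma bounded_one_sub_two_mul_exp {r : ℝ} (hr : 0 ≤ r) :
    |(1 - 2 * r) * Real.exp (-r)| ≤ 2 := by
  rw [abs_mul, abs_of_pos (Real.exp_pos _), Real.exp_neg, mul_inv_le_iff₀ (Real.exp_pos _)]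
  have := Real.add_one_le_exp r
  rw [abs_le]; constructor <;> nlinarith

lemma memLp_one_sub_two_mul_exp :
    MemLp (fun r => (1 - 2 * r) * Real.exp (-r)) 2 (expMeasure 1) := by
  refine MemLp.of_bound (by fun_prop) 2 ?_
  filter_upwards [ae_pos_expMeasure] with r hr
  exact bounded_one_sub_two_mul_exp hr.le

lemma integrableOn_one_sub_two_mul {t : ℝ} (ht : 0 ≤ t) :
    IntegrableOn (fun r => Real.exp (-r) * ((1 - 2 * r) * Real.exp (-r))) (Set.Ioi t) :=
  ((integrable_expMeasure_iff _).1 (memLp_one_sub_two_mul_exp.integrable (by norm_num))).mono_set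
    (Set.Ioi_subset_Ioi ht)

lemma setIntegral_one_sub_two_mul {t : ℝ} (ht : 0 ≤ t) :
    ∫ r in Set.Ioi t, Real.exp (-r) * ((1 - 2 * r) * Real.exp (-r)) =
      -(t * Real.exp (-(2 * t))) := by
  rw [integral_Ioi_of_hasDerivAt_of_tendsto' (fun r _ => hasDerivAt_mul_exp_neg_two r)
    (integrableOn_one_sub_two_mul ht) (m := 0), zero_sub]
  have h := (Real.tendsto_pow_mul_exp_neg_atTop_nhds_zero 1).comp
    (tendsto_id.const_mul_atTop (two_pos : (0 : ℝ) < 2))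
  have h2 := h.const_mul (1 / 2)
  simp only [mul_zero] at h2
  refine h2.congr fun r => ?_
  simp [mul_assoc]

lemma integral_one_sub_two_mul :
    ∫ r, (1 - 2 * r) * Real.exp (-r) ∂(expMeasure 1) = 0 := by
  rw [integral_expMeasure, setIntegral_one_sub_two_mul le_rfl]; simp

/-- For `t ≥ r` the martingale satisfies `M(t,z) = z e^{r(1-2z)} (M⁰(t-r,z) + M¹(t-r,z))`.
Differentiating at `z = 1` and letting `t → ∞` leads formally to this equation for `Z`. -/
theorem exists_derivative_limit {W : Env → ℝ} (hW : Measurable W)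
    (hWmap : envMeasure.map W = expMeasure 1) : ∃ Z : Env → ℝ, Measurable Z ∧
    MemLp Z 2 envMeasure ∧ ∫ e, Z e ∂envMeasure = 0 ∧
    ∀ᵐ e ∂envMeasure,
      Z e = weightedBranch (fun r => (1 - 2 * r) * Real.exp (-r)) W e + branch Z e := by
  have hWL : MemLp W 2 envMeasure := memLp_comp_of_map_eq hW hWmap memLp_id_expMeasure
  obtain ⟨Z, h1, h2, h3, -, h4⟩ := exists_branch_fixedPoint
    (B := weightedBranch (fun r => (1 - 2 * r) * Real.exp (-r)) W) (by fun_prop)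
    (memLp_two_of_secondMoment (by fun_prop) (by
      rw [secondMoment_weightedBranch_eq (by fun_prop) hW]
      refine ENNReal.mul_lt_top (secondMoment_lt_top memLp_one_sub_two_mul_exp)
        (secondMoment_lt_top ?_)
      exact (hWL.comp_measurePreserving measurePreserving_fst).add
        (hWL.comp_measurePreserving measurePreserving_snd)))
    (by rw [integral_weightedBranch (hWL.integrable (by norm_num)), integral_one_sub_two_mul,
      zero_mul])
  exact ⟨Z, h1, h2, h3, h4⟩

/-! ### Time-dependent recursions -/

/-- A jointly measurable family of variables with second moments of order `e^{-t/2}`. -/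
structure DecayFamily (A : ℝ → Env → ℝ) (K : ℝ) : Prop where
  measurable : Measurable (Function.uncurry A)
  bound : ∀ t, 0 ≤ t → secondMoment envMeasure (A t) ≤ ENNReal.ofReal (K * Real.exp (-t / 2))

lemma DecayFamily.measurable_apply {A : ℝ → Env → ℝ} {K : ℝ} (h : DecayFamily A K) (t : ℝ) :
    Measurable (A t) := h.measurable.comp (measurable_const.prodMk measurable_id)

lemma DecayFamily.memLp {A : ℝ → Env → ℝ} {K : ℝ} (h : DecayFamily A K) {t : ℝ} (ht : 0 ≤ t) :
    MemLp (A t) 2 envMeasure :=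
  memLp_two_of_secondMoment (h.measurable_apply t).aestronglyMeasurable
    ((h.bound t ht).trans_lt ENNReal.ofReal_lt_top)

lemma DecayFamily.integrable {A : ℝ → Env → ℝ} {K : ℝ} (h : DecayFamily A K) {t : ℝ}
    (ht : 0 ≤ t) : Integrable (A t) envMeasure := (h.memLp ht).integrable (by norm_num)

lemma DecayFamily.mono {A : ℝ → Env → ℝ} {K L : ℝ} (h : DecayFamily A K) (hKL : K ≤ L) :
    DecayFamily A L :=
  ⟨h.measurable, fun t ht => (h.bound t ht).trans (ENNReal.ofReal_le_ofReal (by gcongr))⟩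

lemma DecayFamily.add_weighted {A B : ℝ → Env → ℝ} {K L : ℝ} (hK : 0 ≤ K) (hL : 0 ≤ L)
    (hA : DecayFamily A K) (hB : DecayFamily B L) {η : ℝ} (hη : 0 < η) :
    DecayFamily (fun t e => A t e + B t e) ((1 + η⁻¹) * K + (1 + η) * L) := by
  refine ⟨hA.measurable.add hB.measurable, fun t ht => ?_⟩
  refine (secondMoment_add_le (hA.measurable_apply t) (hB.measurable_apply t) hη).trans ?_
  rw [add_mul, ENNReal.ofReal_add (p := (1 + η⁻¹) * K * _) (by positivity) (by positivity),
    mul_assoc, mul_assoc, ENNReal.ofReal_mul (p := 1 + η⁻¹) (by positivity),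
    ENNReal.ofReal_mul (p := 1 + η) (by positivity)]
  gcongr
  · exact hA.bound t ht
  · exact hB.bound t ht

lemma DecayFamily.add {A B : ℝ → Env → ℝ} {K L : ℝ} (hK : 0 ≤ K) (hL : 0 ≤ L)
    (hA : DecayFamily A K) (hB : DecayFamily B L) :
    DecayFamily (fun t e => A t e + B t e) (2 * K + 2 * L) := by
  have := hA.add_weighted hK hL hB one_pos
  norm_num at this
  exact this

/-- The contribution of the two subtrees when the root has died by time `t`. -/
noncomputable def cutBranch (c : ℝ → ℝ) (A : ℝ → Env → ℝ) (t : ℝ) (e : Env) : ℝ :=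
  if e [] ≤ t then c (e []) * (A (t - e []) (e.shift false) + A (t - e []) (e.shift true)) else 0

lemma measurable_cutBranch {c : ℝ → ℝ} (hc : Measurable c) {A : ℝ → Env → ℝ}
    (hA : Measurable (Function.uncurry A)) : Measurable (Function.uncurry (cutBranch c A)) := by
  have hA' : ∀ i : Bool, Measurable fun p : ℝ × Env => A (p.1 - p.2 []) (p.2.shift i) := fun i =>
    hA.comp ((measurable_fst.sub ((measurable_pi_apply _).comp measurable_snd)).prodMk
      ((Env.measurable_shift i).comp measurable_snd))
  unfold cutBranch Function.uncurry
  refine Measurable.ite (measurableSet_le (by fun_prop) (by fun_prop)) ?_ measurable_const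
  exact (hc.comp (by fun_prop)).mul ((hA' false).add (hA' true))

/-- After the root dies at time `r`, the two centred independent copies have run for `t - r`. Their
bound `e^{-(t-r)/2}` factors as `e^{-t/2} e^{r/2}`, and the second factor is absorbed into the
moment `M` of the weight. -/
lemma DecayFamily.cutBranch {c : ℝ → ℝ} (hc : Measurable c) {A : ℝ → Env → ℝ} {K M : ℝ}
    (hK : 0 ≤ K) (hA : DecayFamily A K) (h0 : ∀ t, 0 ≤ t → ∫ e, A t e ∂envMeasure = 0)
    (hM : ∫⁻ r, ENNReal.ofReal (c r ^ 2 * Real.exp (r / 2)) ∂(expMeasure 1) ≤ ENNReal.ofReal M) :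
    DecayFamily (cutBranch c A) (2 * K * M) := by
  refine ⟨measurable_cutBranch hc hA.measurable, fun t _ => ?_⟩
  have hA' : ∀ f : ℝ × Env × Env → Env, Measurable f →
      Measurable fun p : ℝ × Env × Env => A (t - p.1) (f p) := fun f hf =>
    hA.measurable.comp ((measurable_const.sub measurable_fst).prodMk hf)
  have hs := lintegral_split (fun r p => ENNReal.ofReal
    ((if r ≤ t then c r * (A (t - r) p.1 + A (t - r) p.2) else 0) ^ 2)) (by
      simp only [Function.uncurry_def]
      refine ENNReal.measurable_ofReal.comp (Measurable.pow_const ?_ 2)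
      refine Measurable.ite (measurableSet_le (by fun_prop) (by fun_prop)) ?_ measurable_const
      exact (hc.comp (by fun_prop)).mul ((hA' (fun p => p.2.1) (by fun_prop)).add
        (hA' (fun p => p.2.2) (by fun_prop))))
  have hs' : secondMoment envMeasure (_root_.cutBranch c A t) = _ := hs
  rw [hs']
  calc _ ≤ ∫⁻ r, ENNReal.ofReal (2 * K * Real.exp (-t / 2)) *
        ENNReal.ofReal (c r ^ 2 * Real.exp (r / 2)) ∂(expMeasure 1) := by
        refine lintegral_mono fun r => ?_
        by_cases hr : r ≤ t
        · simp only [hr, if_true]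
          have ht' : 0 ≤ t - r := sub_nonneg.2 hr
          have h1 := secondMoment_const_mul (ν := envMeasure.prod envMeasure)
            (f := fun p : Env × Env => A (t - r) p.1 + A (t - r) p.2) (by
              have := hA.measurable_apply (t - r)
              fun_prop) (c r)
          rw [secondMoment_add_copy (hA.memLp ht') (h0 _ ht')] at h1
          refine (le_of_eq h1).trans ?_
          calc _ ≤ ENNReal.ofReal (c r ^ 2) *
                (ENNReal.ofReal 2 * ENNReal.ofReal (K * Real.exp (-(t - r) / 2))) := by
                rw [ENNReal.ofReal_ofNat]
                gcongr
                exact hA.bound _ ht'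
            _ = _ := by
                rw [← ENNReal.ofReal_mul (by norm_num), ← ENNReal.ofReal_mul (by positivity),
                  ← ENNReal.ofReal_mul (by positivity)]
                congr 1
                rw [show -(t - r) / 2 = -t / 2 + r / 2 by ring, Real.exp_add]
                ring
        · simp [hr]
    _ = ENNReal.ofReal (2 * K * Real.exp (-t / 2)) *
        ∫⁻ r, ENNReal.ofReal (c r ^ 2 * Real.exp (r / 2)) ∂(expMeasure 1) :=
        lintegral_const_mul _ (by fun_prop)
    _ ≤ ENNReal.ofReal (2 * K * Real.exp (-t / 2)) * ENNReal.ofReal M := by gcongr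
    _ = _ := by
        rw [← ENNReal.ofReal_mul (by positivity)]
        ring_nf

lemma integral_cutBranch {c : ℝ → ℝ} {A : ℝ → Env → ℝ} {t : ℝ}
    (hi : Integrable (cutBranch c A t) envMeasure)
    (hA : ∀ s, 0 ≤ s → Integrable (A s) envMeasure)
    (h0 : ∀ s, 0 ≤ s → ∫ e, A s e ∂envMeasure = 0) :
    ∫ e, cutBranch c A t e ∂envMeasure = 0 := by
  let f : ℝ × Env × Env → ℝ := fun q =>
    if q.1 ≤ t then c q.1 * (A (t - q.1) q.2.1 + A (t - q.1) q.2.2) else 0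
  have hf : cutBranch c A t = f ∘ Env.split := rfl
  have h1 : ∫ e, cutBranch c A t e ∂envMeasure =
      ∫ q, f q ∂((expMeasure 1).prod (envMeasure.prod envMeasure)) := by
    rw [← measurePreserving_split.integral_comp Env.measurableEmbedding_split, hf]; rfl
  rw [hf, measurePreserving_split.integrable_comp_emb Env.measurableEmbedding_split] at hi
  rw [h1, integral_prod _ hi]
  refine integral_eq_zero_of_ae (ae_of_all _ fun r => ?_)
  by_cases hr : r ≤ t
  · simp only [f, hr, if_true, Pi.zero_apply]
    rw [integral_const_mul, integral_add_copy (hA _ (sub_nonneg.2 hr)), h0 _ (sub_nonneg.2 hr)]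
    simp
  · simp [f, hr]

/-- The value is `∫ e^{-5r/2} dr = 2/5`. The decay rate `1/2` works for `branch` because `2 · (2/5)
< 1`; a rate below `1` is what such a contraction needs. -/
lemma lintegral_exp_neg_weight :
    ∫⁻ r, ENNReal.ofReal (Real.exp (-r) ^ 2 * Real.exp (r / 2)) ∂(expMeasure 1) ≤
      ENNReal.ofReal (2 / 5) := by
  have h := integral_exp_neg_mul_Ioi (c := 5 / 2) (by norm_num) 0
  simp only [mul_zero, neg_zero, Real.exp_zero] at h
  rw [lintegral_expMeasure _ (by fun_prop), show (2 / 5 : ℝ) = 1 / (5 / 2) by norm_num, ← h,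
    ofReal_integral_eq_lintegral_ofReal (integrableOn_exp_neg_mul_Ioi (by norm_num) 0)
      (ae_of_all _ fun _ => Real.exp_nonneg _)]
  refine le_of_eq (lintegral_congr fun r => ?_)
  rw [← ENNReal.ofReal_mul (Real.exp_nonneg _), sq, ← Real.exp_add, ← Real.exp_add, ← Real.exp_add]
  ring_nf

/-- The squared weight is at most `4`, and `∫ e^{-r/2} dr = 2`. -/
lemma lintegral_one_sub_two_mul_weight :
    ∫⁻ r, ENNReal.ofReal (((1 - 2 * r) * Real.exp (-r)) ^ 2 * Real.exp (r / 2)) ∂(expMeasure 1) ≤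
      ENNReal.ofReal 8 := by
  have h := integral_exp_neg_mul_Ioi (c := 1 / 2) (by norm_num) 0
  simp only [mul_zero, neg_zero, Real.exp_zero] at h
  rw [lintegral_expMeasure _ (by fun_prop), show (8 : ℝ) = 4 * (1 / (1 / 2)) by norm_num, ← h,
    ENNReal.ofReal_mul (by norm_num),
    ofReal_integral_eq_lintegral_ofReal (integrableOn_exp_neg_mul_Ioi (by norm_num) 0)
      (ae_of_all _ fun _ => Real.exp_nonneg _), ← lintegral_const_mul _ (by fun_prop)]
  refine setLIntegral_mono' measurableSet_Ioi fun r hr => ?_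
  rw [← ENNReal.ofReal_mul (Real.exp_nonneg _), ← ENNReal.ofReal_mul (by norm_num)]
  refine ENNReal.ofReal_le_ofReal ?_
  have h2 : ((1 - 2 * r) * Real.exp (-r)) ^ 2 ≤ 4 := by
    rw [← sq_abs]
    have := bounded_one_sub_two_mul_exp (le_of_lt hr)
    nlinarith [abs_nonneg ((1 - 2 * r) * Real.exp (-r))]
  have h3 : Real.exp (-(1 / 2 * r)) = Real.exp (-r) * Real.exp (r / 2) := by
    rw [← Real.exp_add]; ring_nf
  rw [h3]
  have := mul_pos (Real.exp_pos (-r)) (Real.exp_pos (r / 2))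
  nlinarith

/-- Second moment bounds for families given by a recursion over the first generation. -/
lemma decayFamily_of_recursion {F G : ℕ → ℝ → Env → ℝ} {C : ℝ} (hC : 0 ≤ C)
    (hF0 : ∀ t e, F 0 t e = 0)
    (hF : ∀ n t e, F (n + 1) t e = G n t e + cutBranch (fun r => Real.exp (-r)) (F n) t e)
    (hG : ∀ n, DecayFamily (G n) C)
    (hG0 : ∀ n t, 0 ≤ t → ∫ e, G n t e ∂envMeasure = 0) (n : ℕ) :
    DecayFamily (F n) (90 * C) ∧ ∀ t, 0 ≤ t → ∫ e, F n t e ∂envMeasure = 0 := by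
  induction n with
  | zero =>
    have : F 0 = fun _ _ => 0 := by funext t e; exact hF0 t e
    rw [this]
    exact ⟨⟨measurable_const, fun t _ => by simp [secondMoment]⟩, fun t _ => by simp⟩
  | succ n ih =>
    obtain ⟨h1, h2⟩ := ih
    have hb := h1.cutBranch (c := fun r => Real.exp (-r)) (by fun_prop) (by positivity) h2
      lintegral_exp_neg_weight
    have hfun : F (n + 1) =
        fun t e => G n t e + cutBranch (fun r => Real.exp (-r)) (F n) t e := by
      funext t e; exact hF n t e
    rw [hfun]
    -- With `η = 1/8` the constant reproduces itself: `9 C + (9/8) · (4/5) · 90 C = 90 C`.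
    refine ⟨((hG n).add_weighted hC (by positivity) hb (η := 1 / 8) (by norm_num)).mono
      (le_of_eq (by ring)), fun t ht => ?_⟩
    rw [integral_add ((hG n).integrable ht) (hb.integrable ht), hG0 n t ht,
      integral_cutBranch (hb.integrable ht) (fun s hs => h1.integrable hs) h2, add_zero]

/-! ### Contribution of a root that survives time `t` -/

/-- The root outlives `t` with probability `e^{-t} ≤ e^{-t/2}`. -/
lemma secondMoment_indicator_Ioi_le {a : ℝ → ℝ} (ha : Measurable a) {t M : ℝ} (ht : 0 ≤ t)
    (hM : ∀ r, t < r → |a r| ≤ M) :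
    secondMoment (expMeasure 1) ((Set.Ioi t).indicator a) ≤
      ENNReal.ofReal (M ^ 2 * Real.exp (-t / 2)) := by
  have hm : Measurable ((Set.Ioi t).indicator a) := ha.indicator measurableSet_Ioi
  rw [secondMoment, lintegral_expMeasure _ (by fun_prop)]
  calc _ ≤ ∫⁻ r in Set.Ioi 0, (Set.Ioi t).indicator
        (fun r => ENNReal.ofReal (M ^ 2) * ENNReal.ofReal (Real.exp (-r))) r := by
        refine lintegral_mono fun r => ?_
        by_cases hr : r ∈ Set.Ioi t
        · simp only [Set.indicator_of_mem hr]
          rw [mul_comm]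
          refine mul_le_mul_left (ENNReal.ofReal_le_ofReal ?_) _
          rw [← sq_abs]
          exact pow_le_pow_left₀ (abs_nonneg _) (hM r hr) 2
        · simp [Set.indicator_of_notMem hr]
    _ ≤ ∫⁻ r, (Set.Ioi t).indicator
        (fun r => ENNReal.ofReal (M ^ 2) * ENNReal.ofReal (Real.exp (-r))) r :=
        setLIntegral_le_lintegral _ _
    _ = ENNReal.ofReal (M ^ 2) * ENNReal.ofReal (Real.exp (-t)) := by
        rw [lintegral_indicator measurableSet_Ioi, lintegral_const_mul _ (by fun_prop),
          lintegral_exp_neg_Ioi]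
    _ ≤ _ := by
        rw [← ENNReal.ofReal_mul (by positivity)]
        refine ENNReal.ofReal_le_ofReal ?_
        gcongr
        linarith

lemma measurable_indicator_Ioi {β : Type*} [MeasurableSpace β] {x y a : β → ℝ} (hx : Measurable x)
    (hy : Measurable y) (ha : Measurable a) :
    Measurable fun p : β => if x p < y p then a p else 0 :=
  Measurable.ite (measurableSet_lt hx hy) ha measurable_const

lemma decayFamily_root {a : ℝ → ℝ → ℝ} (ha : Measurable (Function.uncurry a)) {M : ℝ}
    (hM : ∀ t, 0 ≤ t → ∀ r, t < r → |a t r| ≤ M) :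
    DecayFamily (fun t e => (Set.Ioi t).indicator (a t) (e [])) (M ^ 2) := by
  refine ⟨?_, fun t ht => ?_⟩
  · simp only [Set.indicator_apply, Set.mem_Ioi, Function.uncurry_def]
    exact measurable_indicator_Ioi (by fun_prop) (by fun_prop)
      (ha.comp (measurable_fst.prodMk ((measurable_pi_apply _).comp measurable_snd)))
  · have hat : Measurable (a t) := ha.comp (measurable_const.prodMk measurable_id)
    have := secondMoment_indicator_Ioi_le hat ht (hM t ht)
    rwa [secondMoment, ← (measurePreserving_eval []).lintegral_comp
      (by have := hat.indicator (measurableSet_Ioi (a := t)); fun_prop)] at this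

lemma decayFamily_tailBranch {a : ℝ → ℝ} (ha : Measurable a) {F : Env → ℝ} (hF : Measurable F)
    (hL : MemLp F 2 envMeasure) {M : ℝ} (hM : ∀ r, 0 < r → |a r| ≤ M) :
    DecayFamily (fun t => weightedBranch ((Set.Ioi t).indicator a) F)
      (M ^ 2 * (secondMoment (envMeasure.prod envMeasure) fun p => F p.1 + F p.2).toReal) := by
  have hfin : (secondMoment (envMeasure.prod envMeasure) fun p => F p.1 + F p.2) < ∞ :=
    secondMoment_lt_top ((hL.comp_measurePreserving measurePreserving_fst).add
      (hL.comp_measurePreserving measurePreserving_snd))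
  refine ⟨?_, fun t ht => ?_⟩
  · simp only [weightedBranch, Set.indicator_apply, Set.mem_Ioi, Function.uncurry_def]
    exact (measurable_indicator_Ioi (by fun_prop) (by fun_prop) (by fun_prop)).mul (by fun_prop)
  · rw [secondMoment_weightedBranch_eq (ha.indicator measurableSet_Ioi) hF]
    calc _ ≤ ENNReal.ofReal (M ^ 2 * Real.exp (-t / 2)) *
          ENNReal.ofReal (secondMoment (envMeasure.prod envMeasure) fun p => F p.1 + F p.2).toReal := by
          rw [ENNReal.ofReal_toReal hfin.ne]
          gcongr
          exact secondMoment_indicator_Ioi_le ha ht fun r hr => hM r (ht.trans_lt hr)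
      _ = _ := by
          rw [← ENNReal.ofReal_mul (by positivity)]
          ring_nf

lemma integral_indicator_expMeasure (a : ℝ → ℝ) {t : ℝ} (ht : 0 ≤ t) :
    ∫ r, (Set.Ioi t).indicator a r ∂(expMeasure 1) = ∫ r in Set.Ioi t, Real.exp (-r) * a r := by
  rw [integral_expMeasure]
  have : (fun r => Real.exp (-r) * (Set.Ioi t).indicator a r) =
      (Set.Ioi t).indicator (fun r => Real.exp (-r) * a r) := by
    funext r; by_cases hr : r ∈ Set.Ioi t <;> simp [Set.indicator, hr]
  rw [this, setIntegral_indicator measurableSet_Ioi, Set.inter_eq_right.2 (Set.Ioi_subset_Ioi ht)]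

lemma integral_root (a : ℝ → ℝ) {t : ℝ} (ht : 0 ≤ t) (ha : Measurable a) :
    ∫ e : Env, (Set.Ioi t).indicator a (e []) ∂envMeasure =
      ∫ r in Set.Ioi t, Real.exp (-r) * a r := by
  rw [← integral_indicator_expMeasure a ht, ← (measurePreserving_eval []).map_eq,
    integral_map (measurable_pi_apply _).aemeasurable
      (ha.indicator measurableSet_Ioi).aestronglyMeasurable]

/-! ### The deviations from the limits -/

section Deviation

variable (W Z : Env → ℝ)

/-- The deviation `e^{-t} N_t - W`, with the lineages beyond generation `n` neglected. -/
noncomputable def popDev : ℕ → ℝ → Env → ℝ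
  | 0 => fun _ _ => 0
  | n + 1 => fun t e => ((Set.Ioi t).indicator (fun _ => Real.exp (-t)) (e []) +
      weightedBranch ((Set.Ioi t).indicator fun r => -Real.exp (-r)) W e) +
      cutBranch (fun r => Real.exp (-r)) (popDev n) t e

/-- The deviation `M'(t, 1) - Z`, with the lineages beyond generation `n` neglected. -/
noncomputable def derivDev : ℕ → ℝ → Env → ℝ
  | 0 => fun _ _ => 0
  | n + 1 => fun t e => (((Set.Ioi t).indicator (fun _ => -2 * t * Real.exp (-t)) (e []) +
      weightedBranch ((Set.Ioi t).indicator fun r => -((1 - 2 * r) * Real.exp (-r))) W e) +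
      (weightedBranch ((Set.Ioi t).indicator fun r => -Real.exp (-r)) Z e +
      cutBranch (fun r => (1 - 2 * r) * Real.exp (-r)) (popDev W n) t e)) +
      cutBranch (fun r => Real.exp (-r)) (derivDev n) t e

variable {W Z}

/-- The source terms live on the survival of the root. Their means cancel: `e^{-t} · e^{-t}` against
`(e^{-2t}/2) · 2 E[W]`. The bound is uniform in the truncation level. -/
lemma exists_decayFamily_popDev (hW : Measurable W) (hWL : MemLp W 2 envMeasure)
    (hW1 : ∫ e, W e ∂envMeasure = 1) :
    ∃ K, 0 ≤ K ∧ ∀ n, DecayFamily (popDev W n) K ∧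
      ∀ t, 0 ≤ t → ∫ e, popDev W n t e ∂envMeasure = 0 := by
  have h1 := decayFamily_root (a := fun t _ => Real.exp (-t)) (M := 1) (by fun_prop) (by
    intro t ht r _
    rw [abs_of_pos (Real.exp_pos _)]
    exact Real.exp_le_one_iff.2 (by linarith))
  have h2 := decayFamily_tailBranch (a := fun r => -Real.exp (-r)) (M := 1) (by fun_prop) hW hWL (by
    intro r hr
    rw [abs_neg, abs_of_pos (Real.exp_pos _)]
    exact Real.exp_le_one_iff.2 (by linarith))
  have h3 := h1.add (by positivity) (by positivity) h2
  refine ⟨_, by positivity, decayFamily_of_recursion (F := popDev W) (G := fun _ t e =>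
    (Set.Ioi t).indicator (fun _ => Real.exp (-t)) (e []) +
      weightedBranch ((Set.Ioi t).indicator fun r => -Real.exp (-r)) W e) (by positivity)
    (fun _ _ => rfl) (fun _ _ _ => rfl) (fun _ => h3) fun _ t ht => ?_⟩
  rw [integral_add (h1.integrable ht) (h2.integrable ht), integral_root _ ht (by fun_prop),
    integral_weightedBranch (hWL.integrable (by norm_num)), integral_indicator_expMeasure _ ht, hW1,
    integral_mul_const, integral_exp_neg_Ioi]
  have : ∫ r in Set.Ioi t, Real.exp (-r) * -Real.exp (-r) = -(Real.exp (-(2 * t)) / 2) := by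
    rw [← integral_exp_neg_mul_Ioi two_pos t, ← integral_neg]
    refine integral_congr_ae (ae_of_all _ fun r => ?_)
    simp only [mul_neg, ← Real.exp_add]; ring_nf
  rw [this, ← Real.exp_add]
  ring_nf

/-- The population deviation enters as a source term, already controlled and centred. The survival
terms again cancel in mean: `-2t e^{-2t}` against `t e^{-2t} · 2 E[W]`, while the `Z` term has mean
zero. -/
lemma exists_decayFamily_derivDev (hW : Measurable W) (hWL : MemLp W 2 envMeasure)
    (hW1 : ∫ e, W e ∂envMeasure = 1) (hZ : Measurable Z) (hZL : MemLp Z 2 envMeasure)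
    (hZ0 : ∫ e, Z e ∂envMeasure = 0) :
    ∃ K, 0 ≤ K ∧ ∀ n, DecayFamily (derivDev W Z n) K := by
  obtain ⟨K, hK, hD⟩ := exists_decayFamily_popDev hW hWL hW1
  have h1 := decayFamily_root (a := fun t _ => -2 * t * Real.exp (-t)) (M := 2) (by fun_prop) (by
    intro t ht r _
    rw [abs_mul, abs_of_pos (Real.exp_pos _), Real.exp_neg, mul_inv_le_iff₀ (Real.exp_pos _),
      abs_of_nonpos (by linarith)]
    have := Real.add_one_le_exp t
    linarith)
  have h2 := decayFamily_tailBranch (a := fun r => -((1 - 2 * r) * Real.exp (-r))) (M := 2)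
    (by fun_prop) hW hWL (by
      intro r hr
      rw [abs_neg]
      exact bounded_one_sub_two_mul_exp hr.le)
  have h3 := decayFamily_tailBranch (a := fun r => -Real.exp (-r)) (M := 1) (by fun_prop) hZ hZL (by
    intro r hr
    rw [abs_neg, abs_of_pos (Real.exp_pos _)]
    exact Real.exp_le_one_iff.2 (by linarith))
  have h4 := fun n => (hD n).1.cutBranch (c := fun r => (1 - 2 * r) * Real.exp (-r)) (by fun_prop)
    hK (hD n).2 lintegral_one_sub_two_mul_weight
  have h12 := h1.add (by positivity) (by positivity) h2
  have h34 := fun n => h3.add (by positivity) (by positivity) (h4 n)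
  have hall := fun n => h12.add (by positivity) (by positivity) (h34 n)
  refine ⟨_, by positivity, fun n => (decayFamily_of_recursion (F := derivDev W Z)
    (G := fun n t e => (((Set.Ioi t).indicator (fun _ => -2 * t * Real.exp (-t)) (e []) +
      weightedBranch ((Set.Ioi t).indicator fun r => -((1 - 2 * r) * Real.exp (-r))) W e) +
      (weightedBranch ((Set.Ioi t).indicator fun r => -Real.exp (-r)) Z e +
      cutBranch (fun r => (1 - 2 * r) * Real.exp (-r)) (popDev W n) t e))) (by positivity)
    (fun _ _ => rfl) (fun _ _ _ => rfl) hall (fun n t ht => ?_) n).1⟩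
  rw [integral_add (h12.integrable ht) ((h34 n).integrable ht),
    integral_add (h1.integrable ht) (h2.integrable ht),
    integral_add (h3.integrable ht) ((h4 n).integrable ht),
    integral_cutBranch ((h4 n).integrable ht) (fun s hs => (hD n).1.integrable hs) (hD n).2,
    integral_root _ ht (by fun_prop), integral_weightedBranch (hWL.integrable (by norm_num)),
    integral_weightedBranch (hZL.integrable (by norm_num)), integral_indicator_expMeasure _ ht,
    hW1, hZ0, integral_mul_const, integral_exp_neg_Ioi]
  simp only [mul_neg, integral_neg]
  rw [setIntegral_one_sub_two_mul ht, show -(2 * t) = -t + -t by ring, Real.exp_add]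
  ring

end Deviation

/-! ### The tree at a fixed time -/

lemma birthTime_nil (e : Env) : birthTime e [] = 0 := by simp [birthTime]

lemma birthTime_cons (e : Env) (i : Bool) (v : Word) :
    birthTime e (i :: v) = e [] + birthTime (e.shift i) v := by
  simp only [birthTime, List.length_cons]
  rw [Finset.sum_range_succ', add_comm]
  simp [Env.shift]

/-- The time at which the node `u` is replaced by its children. -/
noncomputable def deathTime (e : Env) (u : Word) : ℝ := birthTime e u + e u

lemma deathTime_nil (e : Env) : deathTime e [] = e [] := by simp [deathTime, birthTime_nil]

lemma deathTime_cons (e : Env) (i : Bool) (v : Word) :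
    deathTime e (i :: v) = e [] + deathTime (e.shift i) v := by
  rw [deathTime, birthTime_cons, deathTime, add_assoc]; rfl

lemma birthTime_append (e : Env) (u v : Word) :
    birthTime e (u ++ v) = birthTime e u + birthTime (e.shiftWord u) v := by
  induction u generalizing e with
  | nil => rw [birthTime_nil, zero_add]; rfl
  | cons i u ih => rw [List.cons_append, birthTime_cons, ih, birthTime_cons, Env.shiftWord_cons,
      add_assoc]

lemma birthTime_nonneg {e : Env} (he : ∀ u, 0 < e u) (u : Word) : 0 ≤ birthTime e u :=
  Finset.sum_nonneg fun _ _ => (he _).le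

lemma birthTime_lt_deathTime {e : Env} (he : ∀ u, 0 < e u) (u : Word) :
    birthTime e u < deathTime e u := by
  have := he u
  rw [deathTime]; linarith

lemma deathTime_pos {e : Env} (he : ∀ u, 0 < e u) (u : Word) : 0 < deathTime e u :=
  (birthTime_nonneg he u).trans_lt (birthTime_lt_deathTime he u)

lemma Env.shift_pos {e : Env} (he : ∀ u, 0 < e u) (i : Bool) (u : Word) : 0 < e.shift i u := he _

/-- The children of `u` are born exactly when `u` dies, and all further descendants no earlier. -/
lemma leaves_yuleTree {e : Env} (he : ∀ u, 0 < e u) (t : ℝ) :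
    leaves (yuleTree e t) = {u | birthTime e u ≤ t ∧ t < deathTime e u} := by
  ext u
  simp only [leaves, yuleTree, Set.mem_ofPred_eq, not_le]
  refine and_congr_right fun _ => ⟨fun h => ?_, fun h v hv => ?_⟩
  · have := h [false] (by simp)
    rwa [birthTime_append, birthTime_cons, birthTime_nil, add_zero, Env.shiftWord,
      List.append_nil] at this
  · obtain ⟨i, v, rfl⟩ := List.exists_cons_of_ne_nil hv
    rw [birthTime_append, birthTime_cons]
    have h1 : 0 ≤ birthTime ((e.shiftWord u).shift i) v := birthTime_nonneg (fun _ => he _) v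
    have h2 : e.shiftWord u [] = e u := by simp [Env.shiftWord]
    rw [h2]
    rw [deathTime] at h
    linarith

/-- Every node of generation at least `n` is born after time `t`. -/
def HeightBound (n : ℕ) (e : Env) (t : ℝ) : Prop := ∀ u : Word, n ≤ u.length → t < birthTime e u

lemma HeightBound.shift {n : ℕ} {e : Env} {t : ℝ} (h : HeightBound (n + 1) e t) (i : Bool) :
    HeightBound n (e.shift i) (t - e []) := fun u hu => by
  have := h (i :: u) (by simpa using hu)
  rw [birthTime_cons] at this
  linarith

lemma HeightBound.finite {n : ℕ} {e : Env} {t : ℝ} (h : HeightBound n e t) :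
    {u | birthTime e u ≤ t}.Finite := by
  refine (List.finite_length_lt Bool n).subset fun u hu => ?_
  by_contra hn
  exact absurd (h u (not_lt.1 hn)) (not_lt.2 hu)

lemma HeightBound.finite_leaves {n : ℕ} {e : Env} {t : ℝ} (h : HeightBound n e t) :
    (leaves (yuleTree e t)).Finite := h.finite.subset fun _ hu => hu.1

/-- The nodes that have died by time `t`. -/
def internalNodes (e : Env) (t : ℝ) : Set Word := {u | deathTime e u ≤ t}

lemma HeightBound.finite_internalNodes {n : ℕ} {e : Env} {t : ℝ} (he : ∀ u, 0 < e u)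
    (h : HeightBound n e t) : (internalNodes e t).Finite :=
  h.finite.subset fun u hu => (birthTime_lt_deathTime he u).le.trans hu

/-- The sum of `g` over the leaves at time `t`. -/
noncomputable def leafSum (g : Word → ℝ) (e : Env) (t : ℝ) : ℝ :=
  ∑ᶠ u ∈ leaves (yuleTree e t), g u

/-- The sum of `g` over the nodes dead by time `t`. -/
noncomputable def internalSum (g : Word → ℝ) (e : Env) (t : ℝ) : ℝ :=
  ∑ᶠ u ∈ internalNodes e t, g u

lemma leafSum_of_lt {e : Env} (he : ∀ u, 0 < e u) {t : ℝ} (ht : 0 ≤ t) (h : t < e [])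
    (g : Word → ℝ) : leafSum g e t = g [] := by
  have : leaves (yuleTree e t) = {[]} := by
    rw [leaves_yuleTree he]
    ext u
    simp only [Set.mem_ofPred_eq, Set.mem_singleton_iff]
    constructor
    · rintro ⟨h1, -⟩
      rcases u with _ | ⟨i, v⟩
      · rfl
      · rw [birthTime_cons] at h1
        have := birthTime_nonneg (Env.shift_pos he i) v
        linarith
    · rintro rfl
      rw [birthTime_nil, deathTime_nil]; exact ⟨ht, h⟩
  rw [leafSum, this, finsum_mem_singleton]

lemma internalSum_of_lt {e : Env} (he : ∀ u, 0 < e u) {t : ℝ} (h : t < e [])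
    (g : Word → ℝ) : internalSum g e t = 0 := by
  have : internalNodes e t = ∅ := by
    ext u
    simp only [internalNodes, Set.mem_ofPred_eq, Set.mem_empty_iff_false, iff_false, not_le]
    rcases u with _ | ⟨i, v⟩
    · rwa [deathTime_nil]
    · rw [deathTime_cons]
      have := deathTime_pos (Env.shift_pos he i) v
      linarith
  rw [internalSum, this, finsum_mem_empty]

lemma finsum_mem_image_cons_union {A B : Set Word} (hA : A.Finite) (hB : B.Finite)
    (g : Word → ℝ) :
    ∑ᶠ u ∈ (List.cons false '' A ∪ List.cons true '' B), g u =
      ∑ᶠ u ∈ A, g (false :: u) + ∑ᶠ u ∈ B, g (true :: u) := by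
  rw [finsum_mem_union ?_ (hA.image _) (hB.image _),
    finsum_mem_image List.cons_injective.injOn, finsum_mem_image List.cons_injective.injOn]
  rw [Set.disjoint_left]
  rintro _ ⟨u, _, rfl⟩ ⟨v, _, h⟩
  simp at h

/-- The height bound provides finiteness of the sets of leaves, without which the finitary sums
could take their default value zero. -/
lemma leafSum_of_le {e : Env} (he : ∀ u, 0 < e u) {t : ℝ} (h : e [] ≤ t) {n : ℕ}
    (hn : HeightBound (n + 1) e t) (g : Word → ℝ) :
    leafSum g e t = leafSum (fun v => g (false :: v)) (e.shift false) (t - e []) +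
      leafSum (fun v => g (true :: v)) (e.shift true) (t - e []) := by
  have : leaves (yuleTree e t) =
      List.cons false '' leaves (yuleTree (e.shift false) (t - e [])) ∪
        List.cons true '' leaves (yuleTree (e.shift true) (t - e [])) := by
    rw [leaves_yuleTree he, leaves_yuleTree (Env.shift_pos he _),
      leaves_yuleTree (Env.shift_pos he _)]
    ext u
    rcases u with _ | ⟨_ | _, v⟩
    · simp only [Set.mem_ofPred_eq, deathTime_nil, Set.mem_union, Set.mem_image]
      simp [h]
    all_goals
      simp only [Set.mem_ofPred_eq, deathTime_cons, birthTime_cons, Set.mem_union, Set.mem_image,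
        List.cons.injEq, le_sub_iff_add_le', sub_lt_iff_lt_add']
      simp
  rw [leafSum, this, finsum_mem_image_cons_union (hn.shift _).finite_leaves
    (hn.shift _).finite_leaves]
  rfl

lemma internalSum_of_le {e : Env} (he : ∀ u, 0 < e u) {t : ℝ} (h : e [] ≤ t) {n : ℕ}
    (hn : HeightBound (n + 1) e t) (g : Word → ℝ) :
    internalSum g e t = g [] +
      (internalSum (fun v => g (false :: v)) (e.shift false) (t - e []) +
        internalSum (fun v => g (true :: v)) (e.shift true) (t - e [])) := by
  have hset : internalNodes e t = insert []
      (List.cons false '' internalNodes (e.shift false) (t - e []) ∪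
        List.cons true '' internalNodes (e.shift true) (t - e [])) := by
    ext u
    rcases u with _ | ⟨_ | _, v⟩
    · simp [internalNodes, deathTime_nil, h]
    all_goals
      simp only [internalNodes, Set.mem_ofPred_eq, deathTime_cons, Set.mem_insert_iff,
        Set.mem_union, Set.mem_image, List.cons.injEq, le_sub_iff_add_le']
      simp
  have hf := fun i => (hn.shift i).finite_internalNodes (Env.shift_pos he i)
  rw [internalSum, hset, finsum_mem_insert _ (by simp) (((hf _).image _).union ((hf _).image _)),
    finsum_mem_image_cons_union (hf _) (hf _)]
  rfl

/-- The number of leaves as a real number. -/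
noncomputable def popSize (e : Env) (t : ℝ) : ℝ := leafSum (fun _ => 1) e t

/-- The external path length. -/
noncomputable def pathLength (e : Env) (t : ℝ) : ℝ := leafSum (fun u => u.length) e t

lemma popSize_of_lt {e : Env} (he : ∀ u, 0 < e u) {t : ℝ} (ht : 0 ≤ t) (h : t < e []) :
    popSize e t = 1 := leafSum_of_lt he ht h _

lemma pathLength_of_lt {e : Env} (he : ∀ u, 0 < e u) {t : ℝ} (ht : 0 ≤ t) (h : t < e []) :
    pathLength e t = 0 := by
  rw [pathLength, leafSum_of_lt he ht h]; simp

lemma leafSum_add {n : ℕ} {e : Env} {t : ℝ} (h : HeightBound n e t) (f g : Word → ℝ) :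
    leafSum (fun u => f u + g u) e t = leafSum f e t + leafSum g e t :=
  finsum_mem_add_distrib h.finite_leaves

lemma internalSum_add {n : ℕ} {e : Env} {t : ℝ} (he : ∀ u, 0 < e u) (h : HeightBound n e t)
    (f g : Word → ℝ) :
    internalSum (fun u => f u + g u) e t = internalSum f e t + internalSum g e t :=
  finsum_mem_add_distrib (h.finite_internalNodes he)

lemma HeightBound.not_zero {e : Env} {t : ℝ} (ht : 0 ≤ t) : ¬ HeightBound 0 e t := fun h => by
  have := h [] le_rfl
  rw [birthTime_nil] at this
  linarith

lemma popSize_of_le {e : Env} (he : ∀ u, 0 < e u) {t : ℝ} (h : e [] ≤ t) {n : ℕ}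
    (hn : HeightBound (n + 1) e t) :
    popSize e t = popSize (e.shift false) (t - e []) + popSize (e.shift true) (t - e []) :=
  leafSum_of_le he h hn _

lemma pathLength_of_le {e : Env} (he : ∀ u, 0 < e u) {t : ℝ} (h : e [] ≤ t) {n : ℕ}
    (hn : HeightBound (n + 1) e t) :
    pathLength e t =
      (pathLength (e.shift false) (t - e []) + popSize (e.shift false) (t - e [])) +
      (pathLength (e.shift true) (t - e []) + popSize (e.shift true) (t - e [])) := by
  rw [pathLength, leafSum_of_le he h hn]
  simp only [List.length_cons, Nat.cast_add, Nat.cast_one]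
  rw [leafSum_add (hn.shift false), leafSum_add (hn.shift true)]
  rfl

/-- Each death adds one leaf. The sum over dead nodes is visibly monotone in time, unlike the sum
over leaves. -/
lemma popSize_eq_internalSum (n : ℕ) : ∀ (e : Env) (t : ℝ), (∀ u, 0 < e u) → 0 ≤ t →
    HeightBound n e t → popSize e t = 1 + internalSum (fun _ => 1) e t := by
  induction n with
  | zero => exact fun e t _ ht h => absurd h (HeightBound.not_zero ht)
  | succ n ih =>
    intro e t he ht h
    rcases lt_or_ge t (e []) with h' | h'
    · rw [popSize_of_lt he ht h', internalSum_of_lt he h', add_zero]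
    · rw [popSize_of_le he h' h, internalSum_of_le he h' h,
        ih _ _ (Env.shift_pos he _) (sub_nonneg.2 h') (h.shift _),
        ih _ _ (Env.shift_pos he _) (sub_nonneg.2 h') (h.shift _)]
      ring

/-- The death of a leaf at depth `d` replaces `d` by `2(d+1)`, a gain of `d + 2`. This again
exhibits monotonicity in time. -/
lemma pathLength_eq_internalSum (n : ℕ) : ∀ (e : Env) (t : ℝ), (∀ u, 0 < e u) → 0 ≤ t →
    HeightBound n e t → pathLength e t = internalSum (fun u => u.length + 2) e t := by
  induction n with
  | zero => exact fun e t _ ht h => absurd h (HeightBound.not_zero ht)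
  | succ n ih =>
    intro e t he ht h
    rcases lt_or_ge t (e []) with h' | h'
    · rw [pathLength_of_lt he ht h', internalSum_of_lt he h']
    · have key : ∀ i, internalSum (fun v => ((i :: v).length : ℝ) + 2) (e.shift i) (t - e []) =
          pathLength (e.shift i) (t - e []) + (popSize (e.shift i) (t - e []) - 1) := by
        intro i
        have hf : (fun v : Word => ((i :: v).length : ℝ) + 2) = fun v => (v.length + 2 : ℝ) + 1 := by
          funext v; simp; ring
        rw [hf, internalSum_add (Env.shift_pos he i) (h.shift i),
          ih _ _ (Env.shift_pos he _) (sub_nonneg.2 h') (h.shift _),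
          popSize_eq_internalSum n _ _ (Env.shift_pos he _) (sub_nonneg.2 h') (h.shift _)]
        ring
      rw [pathLength_of_le he h' h, internalSum_of_le he h' h, key, key]
      simp
      ring

lemma internalSum_mono {n : ℕ} {e : Env} {s t : ℝ} (he : ∀ u, 0 < e u) (hst : s ≤ t)
    (h : HeightBound n e t) {g : Word → ℝ} (hg : ∀ u, 0 ≤ g u) :
    internalSum g e s ≤ internalSum g e t := by
  have hsub : internalNodes e s ⊆ internalNodes e t := fun u hu => le_trans hu hst
  have hft := h.finite_internalNodes he
  rw [internalSum, internalSum, finsum_mem_eq_finite_toFinset_sum _ hft,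
    finsum_mem_eq_finite_toFinset_sum _ (hft.subset hsub)]
  exact Finset.sum_le_sum_of_subset_of_nonneg (by simpa using hsub) fun u _ _ => hg u

lemma numLeaves_eq_popSize {n : ℕ} {e : Env} {t : ℝ} (h : HeightBound n e t) :
    (numLeaves (yuleTree e) t : ℝ) = popSize e t := by
  rw [numLeaves, Set.ncard_eq_toFinset_card _ h.finite_leaves, popSize, leafSum,
    finsum_mem_eq_finite_toFinset_sum _ h.finite_leaves]
  simp

/-! ### Deviations from the limits along the tree -/

/-- If no node of generation at least `n` is born by time `t`, the truncation is inactive. The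
fixed-point equation is needed below every node because the recursion unfolds through the tree. -/
lemma popDev_eq {W : Env → ℝ} (n : ℕ) : ∀ (e : Env) (t : ℝ), (∀ u, 0 < e u) → 0 ≤ t →
    HeightBound n e t → (∀ u, W (e.shiftWord u) = branch W (e.shiftWord u)) →
    popDev W n t e = Real.exp (-t) * popSize e t - W e := by
  induction n with
  | zero => exact fun e t _ ht h => absurd h (HeightBound.not_zero ht)
  | succ n ih =>
    intro e t he ht h hW
    have hW0 : W e = branch W e := hW []
    rw [hW0, branch_apply]
    simp only [popDev, weightedBranch, cutBranch, Set.indicator_apply, Set.mem_Ioi]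
    rcases lt_or_ge t (e []) with h' | h'
    · rw [popSize_of_lt he ht h', if_pos h', if_pos h', if_neg (not_le.2 h')]
      ring
    · have hexp : Real.exp (-t) = Real.exp (-e []) * Real.exp (-(t - e [])) := by
        rw [← Real.exp_add]; ring_nf
      rw [popSize_of_le he h' h, if_neg (not_lt.2 h'), if_neg (not_lt.2 h'), if_pos h',
        ih _ _ (Env.shift_pos he _) (sub_nonneg.2 h') (h.shift _) (fun u => hW (false :: u)),
        ih _ _ (Env.shift_pos he _) (sub_nonneg.2 h') (h.shift _) (fun u => hW (true :: u)), hexp]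
      ring

/-- Below the root each leaf gains one level and time restarts at `t - r`. This extra term `(1 - 2r)
N` in `P - 2tN` produces the weight on the population deviation. -/
lemma derivDev_eq {W Z : Env → ℝ} (n : ℕ) : ∀ (e : Env) (t : ℝ), (∀ u, 0 < e u) → 0 ≤ t →
    HeightBound n e t → (∀ u, W (e.shiftWord u) = branch W (e.shiftWord u)) →
    (∀ u, Z (e.shiftWord u) = weightedBranch (fun r => (1 - 2 * r) * Real.exp (-r)) W
      (e.shiftWord u) + branch Z (e.shiftWord u)) →
    derivDev W Z n t e = Real.exp (-t) * (pathLength e t - 2 * t * popSize e t) - Z e := by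
  induction n with
  | zero => exact fun e t _ ht h => absurd h (HeightBound.not_zero ht)
  | succ n ih =>
    intro e t he ht h hW hZ
    have hZ0 : Z e = weightedBranch (fun r => (1 - 2 * r) * Real.exp (-r)) W e + branch Z e := hZ []
    rw [hZ0]
    simp only [derivDev, weightedBranch, cutBranch, Set.indicator_apply, Set.mem_Ioi]
    rcases lt_or_ge t (e []) with h' | h'
    · rw [popSize_of_lt he ht h', pathLength_of_lt he ht h']
      simp only [h', if_true, if_neg (not_le.2 h')]
      ring
    · have hexp : Real.exp (-t) = Real.exp (-e []) * Real.exp (-(t - e [])) := by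
        rw [← Real.exp_add]; ring_nf
      simp only [if_neg (not_lt.2 h'), if_pos h']
      rw [popSize_of_le he h' h, pathLength_of_le he h' h,
        popDev_eq n _ _ (Env.shift_pos he _) (sub_nonneg.2 h') (h.shift _)
          (fun u => hW (false :: u)),
        popDev_eq n _ _ (Env.shift_pos he _) (sub_nonneg.2 h') (h.shift _) (fun u => hW (true :: u)),
        ih _ _ (Env.shift_pos he _) (sub_nonneg.2 h') (h.shift _) (fun u => hW (false :: u))
          (fun u => hZ (false :: u)),
        ih _ _ (Env.shift_pos he _) (sub_nonneg.2 h') (h.shift _) (fun u => hW (true :: u))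
          (fun u => hZ (true :: u)), hexp]
      ring

/-! ### Almost sure regularity of the tree -/

lemma measurable_birthTime (u : Word) : Measurable fun e : Env => birthTime e u :=
  Finset.measurable_sum _ fun _ _ => measurable_pi_apply _

@[fun_prop]
lemma measurable_deathTime (u : Word) : Measurable fun e : Env => deathTime e u :=
  (measurable_birthTime u).add (measurable_pi_apply u)

/-- `∑_{|u| = n} e^{-2 b_u}`, where `b_u` is the birth time of `u`. -/
noncomputable def generationSum (n : ℕ) : Env → ℝ :=
  (weightedBranch fun r => Real.exp (-(2 * r)))^[n] fun _ => 1

lemma generationSum_succ (n : ℕ) :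
    generationSum (n + 1) = weightedBranch (fun r => Real.exp (-(2 * r))) (generationSum n) :=
  Function.iterate_succ_apply' _ _ _

lemma generationSum_nonneg (n : ℕ) (e : Env) : 0 ≤ generationSum n e := by
  induction n generalizing e with
  | zero => exact zero_le_one
  | succ n ih =>
    rw [generationSum_succ]
    exact mul_nonneg (Real.exp_nonneg _) (add_nonneg (ih _) (ih _))

lemma exp_birthTime_le_generationSum (u : Word) (e : Env) :
    Real.exp (-(2 * birthTime e u)) ≤ generationSum u.length e := by
  induction u generalizing e with
  | nil => simp [birthTime_nil, generationSum]
  | cons i u ih =>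
    rw [birthTime_cons, List.length_cons, generationSum_succ, weightedBranch, mul_add, neg_add,
      Real.exp_add]
    gcongr
    refine (ih _).trans ?_
    cases i
    · exact le_add_of_nonneg_right (generationSum_nonneg _ _)
    · exact le_add_of_nonneg_left (generationSum_nonneg _ _)

lemma integrable_exp_neg_two_mul : Integrable (fun r => Real.exp (-(2 * r))) (expMeasure 1) := by
  rw [integrable_expMeasure_iff]
  refine (integrableOn_exp_neg_mul_Ioi (c := 3) (by norm_num) 0).congr_fun (fun r _ => ?_)
    measurableSet_Ioi
  simp only [← Real.exp_add]; ring_nf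

lemma integral_exp_neg_two_mul : ∫ r, Real.exp (-(2 * r)) ∂(expMeasure 1) = 1 / 3 := by
  have h := integral_exp_neg_mul_Ioi (c := 3) (by norm_num) 0
  simp only [mul_zero, neg_zero, Real.exp_zero] at h
  rw [integral_expMeasure, ← h]
  refine integral_congr_ae (ae_of_all _ fun r => ?_)
  simp only [← Real.exp_add]; ring_nf

lemma generationSum_spec (n : ℕ) : Measurable (generationSum n) ∧
    Integrable (generationSum n) envMeasure ∧
    ∫ e, generationSum n e ∂envMeasure = (2 / 3) ^ n := by
  induction n with
  | zero =>
    refine ⟨measurable_const, integrable_const _, ?_⟩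
    simp [generationSum]
  | succ n ih =>
    obtain ⟨h1, h2, h3⟩ := ih
    rw [generationSum_succ]
    refine ⟨by fun_prop, integrable_weightedBranch integrable_exp_neg_two_mul h2, ?_⟩
    rw [integral_weightedBranch h2, h3, integral_exp_neg_two_mul, pow_succ]
    ring

/-- The generation sums have means `(2/3)^n`, so they tend to zero almost surely, which forces every
birth time in a late generation to be large. With exponent `1` instead of `2` the means would stay
equal to one. -/
lemma ae_exists_heightBound : ∀ᵐ e ∂envMeasure, ∀ t, ∃ n, HeightBound n e t := by
  have h := ae_summable_of_tsum_lintegral (ν := envMeasure) (f := generationSum)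
    (fun n => (generationSum_spec n).1.aemeasurable) generationSum_nonneg
    (summable_geometric_of_lt_one (by norm_num) (by norm_num : (2 / 3 : ℝ) < 1)) fun n => by
      rw [← (generationSum_spec n).2.2, ofReal_integral_eq_lintegral_ofReal
        (generationSum_spec n).2.1 (ae_of_all _ (generationSum_nonneg n))]
  filter_upwards [h] with e he t
  obtain ⟨n, hn⟩ := eventually_atTop.1
    (he.tendsto_atTop_zero.eventually_lt_const (Real.exp_pos (-(2 * t))))
  refine ⟨n, fun u hu => ?_⟩
  have := Real.exp_lt_exp.1 ((exp_birthTime_le_generationSum u e).trans_lt (hn _ hu))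
  linarith

/-! ### Distinctness of the death times -/

lemma ae_of_ae_split {p : ℝ → Env → Env → Prop}
    (hp : MeasurableSet {q : ℝ × Env × Env | p q.1 q.2.1 q.2.2})
    (h : ∀ r, ∀ᵐ x ∂envMeasure, ∀ᵐ y ∂envMeasure, p r x y) :
    ∀ᵐ e ∂envMeasure, p (e []) (e.shift false) (e.shift true) := by
  have h1 : ∀ᵐ q ∂((expMeasure 1).prod (envMeasure.prod envMeasure)), p q.1 q.2.1 q.2.2 := by
    rw [Measure.ae_prod_iff_ae_ae hp]
    refine ae_of_all _ fun r => ?_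
    have hr := hp.preimage (measurable_prodMk_left (x := r))
    exact (Measure.ae_prod_iff_ae_ae hr).2 (h r)
  exact measurePreserving_split.quasiMeasurePreserving.ae h1

lemma ae_deathTime_ne (u : Word) (c : ℝ) : ∀ᵐ e ∂envMeasure, deathTime e u ≠ c := by
  induction u generalizing c with
  | nil =>
    have h : ∀ᵐ x ∂(expMeasure 1), x ≠ c :=
      expMeasure_absolutelyContinuous.ae_le (Measure.ae_ne volume c)
    filter_upwards [(measurePreserving_eval []).quasiMeasurePreserving.ae h] with e he
    rwa [deathTime_nil]
  | cons i u ih =>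
    have hm : ∀ f : ℝ × Env × Env → Env, Measurable f →
        MeasurableSet {q : ℝ × Env × Env | q.1 + deathTime (f q) u ≠ c} := fun f hf => by
      have hfm : Measurable fun q => deathTime (f q) u := (measurable_deathTime u).comp hf
      exact (measurableSet_eq_fun (measurable_fst.add hfm) measurable_const).compl
    simp only [deathTime_cons]
    cases i
    · refine ae_of_ae_split (p := fun r x _ => r + deathTime x u ≠ c)
        (hm (fun q => q.2.1) (by fun_prop)) fun r => ?_
      filter_upwards [ih (c - r)] with x hx
      exact ae_of_all _ fun _ h => hx (by linarith)
    · refine ae_of_ae_split (p := fun r _ y => r + deathTime y u ≠ c)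
        (hm (fun q => q.2.2) (by fun_prop)) fun r => ae_of_all _ fun _ => ?_
      filter_upwards [ih (c - r)] with x hx
      exact fun h => hx (by linarith)

/-- After removing the common prefix, either one node is an ancestor and dies strictly earlier, or
the two lie in independent subtrees and a death time has no atoms. -/
lemma ae_deathTime_ne_deathTime {u v : Word} (huv : u ≠ v) :
    ∀ᵐ e ∂envMeasure, deathTime e u ≠ deathTime e v := by
  have hroot : ∀ i (w : Word), ∀ᵐ e : Env ∂envMeasure, deathTime e [] ≠ deathTime e (i :: w) := by
    intro i w
    filter_upwards [ae_env_pos] with e he h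
    rw [deathTime_nil, deathTime_cons] at h
    have := deathTime_pos (Env.shift_pos he i) w
    linarith
  have hdiff : ∀ u v : Word, ∀ᵐ e : Env ∂envMeasure,
      deathTime e (false :: u) ≠ deathTime e (true :: v) := by
    intro u v
    simp only [deathTime_cons]
    refine ae_of_ae_split (p := fun r x y => r + deathTime x u ≠ r + deathTime y v) ?_
      fun r => ae_of_all _ fun x => ?_
    · exact (measurableSet_eq_fun (by fun_prop) (by fun_prop)).compl
    · filter_upwards [ae_deathTime_ne v (deathTime x u)] with y hy h
      exact hy (by linarith)
  induction u generalizing v with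
  | nil =>
    obtain ⟨i, w, rfl⟩ := List.exists_cons_of_ne_nil huv.symm
    exact hroot i w
  | cons i u ih =>
    rcases v with _ | ⟨j, v⟩
    · filter_upwards [hroot i u] with e he using he.symm
    · by_cases hij : i = j
      · subst hij
        have huv' : u ≠ v := fun h => huv (by rw [h])
        filter_upwards [ae_shift (ih huv') i] with e he
        rw [deathTime_cons, deathTime_cons]
        exact fun h => he (by linarith)
      · cases i <;> cases j
        · exact absurd rfl hij
        · exact hdiff u v
        · filter_upwards [hdiff v u] with e he using he.symm
        · exact absurd rfl hij

lemma ae_injective_deathTime : ∀ᵐ e ∂envMeasure, Function.Injective (deathTime e) := by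
  have : ∀ᵐ e ∂envMeasure, ∀ u v, u ≠ v → deathTime e u ≠ deathTime e v := by
    refine ae_all_iff.2 fun u => ae_all_iff.2 fun v => ?_
    by_cases h : u = v
    · exact ae_of_all _ fun _ h' => absurd h h'
    · filter_upwards [ae_deathTime_ne_deathTime h] with e he _ using he
  filter_upwards [this] with e he u v huv
  by_contra hne
  exact he u v hne huv

/-! ### From a logarithmic skeleton to continuous time -/

/-- The times `8 log (k + 1)`. -/
noncomputable def skeleton (k : ℕ) : ℝ := 8 * Real.log (k + 1)

lemma skeleton_nonneg (k : ℕ) : 0 ≤ skeleton k :=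
  mul_nonneg (by norm_num) (Real.log_nonneg (by linarith [k.cast_nonneg (α := ℝ)]))

lemma skeleton_le (k : ℕ) : skeleton k ≤ 8 * (k + 1) :=
  mul_le_mul_of_nonneg_left (Real.log_le_self (by positivity)) (by norm_num)

/-- The factor `8` in the skeleton makes this fourth power, which stays summable after
multiplication by `skeleton k ^ 2 ≤ 64 (k+1)²`. -/
lemma exp_neg_skeleton (k : ℕ) : Real.exp (-skeleton k / 2) = (((k : ℝ) + 1) ^ 4)⁻¹ := by
  rw [← Real.exp_log (by positivity : (0 : ℝ) < (((k : ℝ) + 1) ^ 4)⁻¹), Real.log_inv, Real.log_pow,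
    skeleton]
  push_cast
  ring_nf

lemma tendsto_nat_add_one : Tendsto (fun k : ℕ => (k : ℝ) + 1) atTop atTop :=
  tendsto_atTop_add_const_right _ _ tendsto_natCast_atTop_atTop

lemma tendsto_skeleton : Tendsto skeleton atTop atTop :=
  (Real.tendsto_log_atTop.comp tendsto_nat_add_one).const_mul_atTop (by norm_num)

/-- The ratio `e^{t_{k+1} - t_k}` of the skeleton. -/
noncomputable def skeletonRatio (k : ℕ) : ℝ := (1 + 1 / ((k : ℝ) + 1)) ^ 8

lemma skeletonRatio_pos (k : ℕ) : 0 < skeletonRatio k := by unfold skeletonRatio; positivity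

lemma skeleton_succ (k : ℕ) : skeleton (k + 1) = skeleton k + Real.log (skeletonRatio k) := by
  have h1 : (0 : ℝ) < (k : ℝ) + 1 := by positivity
  have h2 : (((k + 1 : ℕ) : ℝ) + 1) = (k + 1) * (1 + 1 / ((k : ℝ) + 1)) := by
    field_simp; push_cast; ring
  rw [skeleton, h2, Real.log_mul h1.ne' (by positivity), skeletonRatio, Real.log_pow, skeleton]
  push_cast; ring

lemma exp_neg_skeleton_succ (k : ℕ) :
    Real.exp (-skeleton k) = skeletonRatio k * Real.exp (-skeleton (k + 1)) := by
  rw [skeleton_succ, neg_add, Real.exp_add, Real.exp_neg (Real.log _),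
    Real.exp_log (skeletonRatio_pos k)]
  field_simp [(skeletonRatio_pos k).ne']

lemma tendsto_skeletonRatio : Tendsto skeletonRatio atTop (𝓝 1) := by
  have h := (tendsto_one_div_add_atTop_nhds_zero_nat (𝕜 := ℝ)).const_add 1
  have h8 := h.pow 8
  rw [add_zero, one_pow] at h8
  exact h8

/-- The ratio differs from one by `O(1/k)`, while the skeleton grows like `log k`. -/
lemma tendsto_skeletonRatio_sub_one_mul :
    Tendsto (fun k => (skeletonRatio k - 1) * skeleton k) atTop (𝓝 0) := by
  have h0 := (tendsto_one_div_add_atTop_nhds_zero_nat (𝕜 := ℝ)).const_add 1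
  have h1 : Tendsto (fun k : ℕ => ∑ j ∈ Finset.range 8, (1 + 1 / ((k : ℝ) + 1)) ^ j) atTop
      (𝓝 (∑ j ∈ Finset.range 8, (1 + 0) ^ j)) :=
    tendsto_finsetSum _ fun j _ => h0.pow j
  have h2 : Tendsto (fun k : ℕ => 8 * (Real.log ((k : ℝ) + 1) / ((k : ℝ) + 1))) atTop (𝓝 0) := by
    have := (Real.isLittleO_log_id_atTop.tendsto_div_nhds_zero.comp tendsto_nat_add_one).const_mul 8
    simpa [Function.comp_def] using this
  have h3 := h2.mul h1
  rw [zero_mul] at h3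
  refine h3.congr fun k => ?_
  rw [skeletonRatio, skeleton, ← mul_geom_sum]
  ring

/-- Between consecutive skeleton times, monotonicity sandwiches `e^{-t} F t`. The loss is a factor
`ρ_k^{±1}`, and it is harmless even against the linear growth `α t`, because `(ρ_k - 1) t_k → 0`. -/
theorem tendsto_of_tendsto_skeleton {F : ℝ → ℝ} (hF : MonotoneOn F (Set.Ici 0)) (hF0 : 0 ≤ F 0) {α β : ℝ}
    (hα : 0 ≤ α)
    (h : Tendsto (fun k => Real.exp (-skeleton k) * F (skeleton k) - (α * skeleton k + β)) atTop
      (𝓝 0)) :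
    Tendsto (fun t => Real.exp (-t) * F t - (α * t + β)) atTop (𝓝 0) := by
  set ε : ℕ → ℝ := fun k => Real.exp (-skeleton k) * F (skeleton k) - (α * skeleton k + β) with hε
  set ρ := skeletonRatio with hρ
  have hρ1 : Tendsto ρ atTop (𝓝 1) := tendsto_skeletonRatio
  have hρt := tendsto_skeletonRatio_sub_one_mul
  have hlog : Tendsto (fun k => Real.log (ρ k)) atTop (𝓝 0) := by
    simpa using hρ1.log one_ne_zero
  have hρ0 : Tendsto (fun k => ρ k - 1) atTop (𝓝 0) := by simpa using hρ1.sub_const 1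
  have hup : Tendsto (fun k => Real.exp (-skeleton k) * F (skeleton (k + 1)) -
      (α * skeleton k + β)) atTop (𝓝 0) := by
    have h1 : Tendsto (fun k => ρ k * ε (k + 1) + (α * ((ρ k - 1) * skeleton k) +
        α * ((ρ k - 1) * Real.log (ρ k)) + (ρ k - 1) * β) + α * Real.log (ρ k)) atTop
        (𝓝 (1 * 0 + (α * 0 + α * (0 * 0) + 0 * β) + α * 0)) :=
      ((hρ1.mul ((tendsto_add_atTop_iff_nat 1).2 h)).add (((hρt.const_mul α).add
        ((hρ0.mul hlog).const_mul α)).add (hρ0.mul_const β))).add (hlog.const_mul α)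
    simp only [mul_zero, add_zero, zero_mul] at h1
    refine h1.congr fun k => ?_
    simp only [hε]
    linear_combination (-F (skeleton (k + 1))) * exp_neg_skeleton_succ k -
      ρ k * α * skeleton_succ k
  have hlow : Tendsto (fun k => Real.exp (-skeleton (k + 1)) * F (skeleton k) -
      (α * skeleton (k + 1) + β)) atTop (𝓝 0) := by
    have h1 : Tendsto (fun k => (ρ k)⁻¹ * ε k - (ρ k)⁻¹ * (α * ((ρ k - 1) * skeleton k) +
        (ρ k - 1) * β) - α * Real.log (ρ k)) atTop
        (𝓝 (1⁻¹ * 0 - 1⁻¹ * (α * 0 + 0 * β) - α * 0)) :=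
      (((hρ1.inv₀ one_ne_zero).mul h).sub ((hρ1.inv₀ one_ne_zero).mul
        ((hρt.const_mul α).add (hρ0.mul_const β)))).sub (hlog.const_mul α)
    simp only [mul_zero, add_zero, zero_mul, sub_zero] at h1
    refine h1.congr fun k => ?_
    have hne : ρ k ≠ 0 := (skeletonRatio_pos k).ne'
    simp only [hε]
    linear_combination (ρ k)⁻¹ * F (skeleton k) * exp_neg_skeleton_succ k + α * skeleton_succ k +
      (Real.exp (-skeleton (k + 1)) * F (skeleton k) - α * skeleton k - β) * inv_mul_cancel₀ hne
  -- The condition `t_k ≤ t < t_{k+1}` means `k + 1 ≤ e^{t/8} < k + 2`. The natural subtraction is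
  -- genuine for `t ≥ 0`, as the floor is then at least one.
  have hK : Tendsto (fun t : ℝ => ⌊Real.exp (t / 8)⌋₊ - 1) atTop atTop :=
    (tendsto_sub_atTop_nat 1).comp (tendsto_nat_floor_atTop.comp
      (Real.tendsto_exp_atTop.comp (tendsto_id.atTop_div_const (by norm_num))))
  have hbd : ∀ t : ℝ, 0 ≤ t → skeleton (⌊Real.exp (t / 8)⌋₊ - 1) ≤ t ∧
      t ≤ skeleton (⌊Real.exp (t / 8)⌋₊ - 1 + 1) := by
    intro t ht
    have h1 : 1 ≤ ⌊Real.exp (t / 8)⌋₊ := by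
      rw [Nat.one_le_floor_iff]
      exact Real.one_le_exp (by positivity)
    obtain ⟨m, hm⟩ := Nat.exists_eq_add_of_le' h1
    have h2 := Nat.floor_le (Real.exp_pos (t / 8)).le
    have h3 := Nat.lt_floor_add_one (Real.exp (t / 8))
    rw [hm] at h2 h3 ⊢
    push_cast at h2 h3
    rw [Nat.add_sub_cancel, skeleton, skeleton]
    constructor
    · have := (Real.log_le_iff_le_exp (by positivity)).2 h2
      linarith
    · have := (Real.le_log_iff_exp_le (by positivity)).2 h3.le
      push_cast
      linarith
  refine tendsto_of_tendsto_of_tendsto_of_le_of_le' (hlow.comp hK) (hup.comp hK) ?_ ?_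
  · filter_upwards [eventually_ge_atTop 0] with t ht
    obtain ⟨h1, h2⟩ := hbd t ht
    simp only [Function.comp_apply]
    set k := ⌊Real.exp (t / 8)⌋₊ - 1
    have h3 : F (skeleton k) ≤ F t := hF (skeleton_nonneg k) ht h1
    have h4 : 0 ≤ F (skeleton k) := hF0.trans (hF (Set.mem_Ici.2 le_rfl) (skeleton_nonneg k) (skeleton_nonneg k))
    have h5 : Real.exp (-skeleton (k + 1)) * F (skeleton k) ≤ Real.exp (-t) * F t := by gcongr
    have h6 : α * t ≤ α * skeleton (k + 1) := by gcongr
    linarith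
  · filter_upwards [eventually_ge_atTop 0] with t ht
    obtain ⟨h1, h2⟩ := hbd t ht
    simp only [Function.comp_apply]
    set k := ⌊Real.exp (t / 8)⌋₊ - 1
    have h3 : F t ≤ F (skeleton (k + 1)) := hF ht (skeleton_nonneg _) h2
    have h4 : 0 ≤ F t := hF0.trans (hF (Set.mem_Ici.2 le_rfl) ht ht)
    have h5 : Real.exp (-t) * F t ≤ Real.exp (-skeleton k) * F (skeleton (k + 1)) := by gcongr
    have h6 : α * skeleton k ≤ α * t := by gcongr
    linarith

/-! ### Almost sure convergence along the skeleton -/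

/-- The uniform bounds pass to the limit in `n` by Fatou, and the second moments of `t_k A(t_k)` are
summable. The extra factor `t_k` is needed for the term `2t (e^{-t} N_t - W)`. -/
theorem ae_tendsto_skeleton {A : ℝ → Env → ℝ} {F : ℕ → ℝ → Env → ℝ} {K : ℝ} (hK : 0 ≤ K)
    (hF : ∀ n, DecayFamily (F n) K)
    (hlim : ∀ t, 0 ≤ t → ∀ᵐ e ∂envMeasure, Tendsto (fun n => F n t e) atTop (𝓝 (A t e))) :
    ∀ᵐ e ∂envMeasure, Tendsto (fun k => skeleton k * A (skeleton k) e) atTop (𝓝 0) := by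
  have hAm : ∀ t, 0 ≤ t → AEMeasurable (A t) envMeasure := fun t ht =>
    aemeasurable_of_tendsto_metrizable_ae atTop (fun n => ((hF n).measurable_apply t).aemeasurable)
      (hlim t ht)
  have hA : ∀ t, 0 ≤ t →
      secondMoment envMeasure (A t) ≤ ENNReal.ofReal (K * Real.exp (-t / 2)) := fun t ht =>
    lintegral_le_of_ae_tendsto (fun n => (hF n).measurable_apply t) (hlim t ht)
      fun n => (hF n).bound t ht
  have hc : Summable fun k : ℕ => 64 * K * (((k : ℝ) + 1) ^ 2)⁻¹ := by
    have := (summable_nat_add_iff 1).2 (Real.summable_one_div_nat_pow.2 one_lt_two)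
    simpa using this.mul_left (64 * K)
  have hs := ae_summable_of_tsum_lintegral (ν := envMeasure)
    (f := fun k e => (skeleton k * A (skeleton k) e) ^ 2)
    (fun k => ((hAm _ (skeleton_nonneg k)).const_mul _).pow_const 2) (fun k e => sq_nonneg _) hc
    fun k => by
      simp only [mul_pow]
      calc ∫⁻ e, ENNReal.ofReal (skeleton k ^ 2 * A (skeleton k) e ^ 2) ∂envMeasure
          = ENNReal.ofReal (skeleton k ^ 2) * secondMoment envMeasure (A (skeleton k)) := by
            rw [secondMoment, ← lintegral_const_mul'' _
              ((hAm _ (skeleton_nonneg k)).pow_const 2).ennreal_ofReal]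
            exact lintegral_congr fun e => ENNReal.ofReal_mul (sq_nonneg _)
        _ ≤ ENNReal.ofReal (skeleton k ^ 2) *
            ENNReal.ofReal (K * Real.exp (-skeleton k / 2)) := by
            gcongr
            exact hA _ (skeleton_nonneg k)
        _ ≤ _ := by
            rw [← ENNReal.ofReal_mul (sq_nonneg _), exp_neg_skeleton]
            refine ENNReal.ofReal_le_ofReal ?_
            have h1 : skeleton k ^ 2 ≤ (8 * (k + 1)) ^ 2 :=
              pow_le_pow_left₀ (skeleton_nonneg k) (skeleton_le k) 2
            calc skeleton k ^ 2 * (K * (((k : ℝ) + 1) ^ 4)⁻¹)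
                ≤ (8 * (k + 1)) ^ 2 * (K * (((k : ℝ) + 1) ^ 4)⁻¹) := by gcongr
              _ = _ := by field_simp; ring
  filter_upwards [hs] with e he
  have h := he.tendsto_atTop_zero.sqrt
  simp only [Real.sqrt_sq_eq_abs, Real.sqrt_zero] at h
  exact (tendsto_zero_iff_abs_tendsto_zero _).2 h

/-! ### Environments with regular growth -/

/-- An environment whose Yule tree is locally finite, has distinct death times, and grows as
prescribed by the limits `W e` and `Z e`. -/
structure RegularEnv (W Z : Env → ℝ) (e : Env) : Prop where
  pos : ∀ u, 0 < e u
  height : ∀ t, ∃ n, HeightBound n e t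
  injective : Function.Injective (deathTime e)
  limit_pos : 0 < W e
  tendsto_popSize : Tendsto (fun t => Real.exp (-t) * popSize e t) atTop (𝓝 (W e))
  tendsto_deriv : Tendsto (fun t => Real.exp (-t) * (pathLength e t - 2 * t * popSize e t)) atTop
    (𝓝 (Z e))

lemma popSize_monotoneOn {e : Env} (he : ∀ u, 0 < e u) (hh : ∀ t, ∃ n, HeightBound n e t) :
    MonotoneOn (popSize e) (Set.Ici 0) := by
  intro s hs t ht hst
  obtain ⟨m, hm⟩ := hh s
  obtain ⟨n, hn⟩ := hh t
  rw [popSize_eq_internalSum m e s he hs hm, popSize_eq_internalSum n e t he ht hn]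
  exact add_le_add_right (internalSum_mono he hst hn fun _ => zero_le_one) _

lemma pathLength_monotoneOn {e : Env} (he : ∀ u, 0 < e u) (hh : ∀ t, ∃ n, HeightBound n e t) :
    MonotoneOn (pathLength e) (Set.Ici 0) := by
  intro s hs t ht hst
  obtain ⟨m, hm⟩ := hh s
  obtain ⟨n, hn⟩ := hh t
  rw [pathLength_eq_internalSum m e s he hs hm, pathLength_eq_internalSum n e t he ht hn]
  exact internalSum_mono he hst hn fun _ => by positivity

lemma leafSum_nonneg {g : Word → ℝ} (hg : ∀ u, 0 ≤ g u) (e : Env) (t : ℝ) : 0 ≤ leafSum g e t :=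
  finsum_nonneg fun u => finsum_nonneg fun _ => hg u

/-- The difference `P_t - 2t N_t` is not obviously monotone, so `N_t`, `t N_t` and `P_t` are
interpolated separately, with asymptotes `W`, `W t` and `2 W t + Z`; the linear terms then cancel.
-/
theorem ae_regularEnv {W Z : Env → ℝ} (hW : Measurable W) (hWmap : envMeasure.map W = expMeasure 1)
    (hWfix : ∀ᵐ e ∂envMeasure, W e = branch W e) (hZ : Measurable Z) (hZL : MemLp Z 2 envMeasure)
    (hZ0 : ∫ e, Z e ∂envMeasure = 0) (hZfix : ∀ᵐ e ∂envMeasure,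
      Z e = weightedBranch (fun r => (1 - 2 * r) * Real.exp (-r)) W e + branch Z e) :
    ∀ᵐ e ∂envMeasure, RegularEnv W Z e := by
  have hWL : MemLp W 2 envMeasure := memLp_comp_of_map_eq hW hWmap memLp_id_expMeasure
  have hW1 : ∫ e, W e ∂envMeasure = 1 := by
    rw [← integral_id_expMeasure, ← hWmap, integral_map hW.aemeasurable (by fun_prop)]
  have hWpos : ∀ᵐ e ∂envMeasure, 0 < W e :=
    (MeasurePreserving.mk hW hWmap).quasiMeasurePreserving.ae ae_pos_expMeasure
  obtain ⟨K, hK, hpop⟩ := exists_decayFamily_popDev hW hWL hW1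
  obtain ⟨L, hL, hder⟩ := exists_decayFamily_derivDev hW hWL hW1 hZ hZL hZ0
  have hbase : ∀ᵐ e ∂envMeasure, (∀ u, 0 < e u) ∧ (∀ t, ∃ n, HeightBound n e t) ∧
      (∀ u, W (e.shiftWord u) = branch W (e.shiftWord u)) ∧
      (∀ u, Z (e.shiftWord u) = weightedBranch (fun r => (1 - 2 * r) * Real.exp (-r)) W
        (e.shiftWord u) + branch Z (e.shiftWord u)) := by
    filter_upwards [ae_env_pos, ae_exists_heightBound, ae_shiftWord hWfix, ae_shiftWord hZfix]
      with e h1 h2 h3 h4 using ⟨h1, h2, h3, h4⟩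
  have hmono : ∀ {m n : ℕ} {e : Env} {t : ℝ}, HeightBound m e t → m ≤ n → HeightBound n e t :=
    fun h hmn u hu => h u (hmn.trans hu)
  have hs1 := ae_tendsto_skeleton (A := fun t e => Real.exp (-t) * popSize e t - W e) hK
    (fun n => (hpop n).1) fun t ht => by
      filter_upwards [hbase] with e he
      obtain ⟨m, hm⟩ := he.2.1 t
      refine tendsto_const_nhds.congr' ?_
      filter_upwards [eventually_ge_atTop m] with n hn
      exact (popDev_eq n e t he.1 ht (hmono hm hn) he.2.2.1).symm
  have hs2 := ae_tendsto_skeleton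
    (A := fun t e => Real.exp (-t) * (pathLength e t - 2 * t * popSize e t) - Z e) hL hder
    fun t ht => by
      filter_upwards [hbase] with e he
      obtain ⟨m, hm⟩ := he.2.1 t
      refine tendsto_const_nhds.congr' ?_
      filter_upwards [eventually_ge_atTop m] with n hn
      exact (derivDev_eq n e t he.1 ht (hmono hm hn) he.2.2.1 he.2.2.2).symm
  have hdrop : ∀ A : ℕ → ℝ, Tendsto (fun k => skeleton k * A k) atTop (𝓝 0) →
      Tendsto A atTop (𝓝 0) := by
    intro A hA
    have h := (tendsto_inv_atTop_zero.comp tendsto_skeleton).mul hA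
    rw [zero_mul] at h
    refine h.congr' ?_
    filter_upwards [tendsto_skeleton.eventually_gt_atTop 0] with k hk
    simp only [Function.comp_apply]
    field_simp
  filter_upwards [hbase, hs1, hs2, ae_injective_deathTime, hWpos] with e he h1 h2 hinj hWe
  obtain ⟨hpos, hh, -, -⟩ := he
  have hN := popSize_monotoneOn hpos hh
  have hN0 : ∀ t, 0 ≤ popSize e t := leafSum_nonneg (fun _ => zero_le_one) e
  have l1 := tendsto_of_tendsto_skeleton hN (hN0 0) (α := 0) (β := W e) le_rfl
    ((hdrop _ h1).congr fun k => by ring)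
  have l2 := tendsto_of_tendsto_skeleton (F := fun t => t * popSize e t)
    (fun s hs t ht hst => mul_le_mul hst (hN hs ht hst) (hN0 s) ht) (by simp) (α := W e) (β := 0)
    hWe.le (h1.congr fun k => by ring)
  -- This uses `e^{-t} P - (2 W t + Z) = (e^{-t}(P - 2tN) - Z) + 2t (e^{-t} N - W)`.
  have l3 := tendsto_of_tendsto_skeleton (pathLength_monotoneOn hpos hh)
    (leafSum_nonneg (fun _ => Nat.cast_nonneg _) e 0) (α := 2 * W e) (β := Z e) (by positivity) (by
      have := (hdrop _ h2).add (h1.const_mul 2)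
      simp only [mul_zero, add_zero] at this
      exact this.congr fun k => by ring)
  refine ⟨hpos, hh, hinj, hWe, ?_, ?_⟩
  · have := l1.add_const (W e)
    rw [zero_add] at this
    exact this.congr fun t => by ring
  · have := (l3.sub (l2.const_mul 2)).add_const (Z e)
    simp only [mul_zero, sub_zero, zero_add] at this
    exact this.congr fun t => by ring

/-! ### Derivatives at `z = 1` -/

lemma hasDerivAt_levelPoly {T : Set Word} (hT : (leaves T).Finite) :
    HasDerivAt (fun z => levelPoly T z) (∑ᶠ u ∈ leaves T, (u.length : ℝ)) 1 := by
  simp only [levelPoly, finsum_mem_eq_finite_toFinset_sum _ hT]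
  refine HasDerivAt.fun_sum fun u _ => ?_
  simpa using hasDerivAt_pow u.length (1 : ℝ)

lemma levelPoly_one_yuleTree (e : Env) (t : ℝ) : levelPoly (yuleTree e t) 1 = popSize e t := by
  simp [levelPoly, popSize, leafSum]

lemma hasDerivAt_levelPoly_yuleTree {n : ℕ} {e : Env} {t : ℝ} (h : HeightBound n e t) :
    HasDerivAt (fun z => levelPoly (yuleTree e t) z) (pathLength e t) 1 :=
  hasDerivAt_levelPoly h.finite_leaves

lemma yuleM'_one {n : ℕ} {e : Env} {t : ℝ} (h : HeightBound n e t) :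
    yuleM' (yuleTree e) t 1 = Real.exp (-t) * (pathLength e t - 2 * t * popSize e t) := by
  have h1 : HasDerivAt (fun z : ℝ => Real.exp (t * (1 - 2 * z)))
      (Real.exp (t * (1 - 2 * 1)) * (t * -(2 * 1))) 1 :=
    ((((hasDerivAt_id (1 : ℝ)).const_mul 2).const_sub 1).const_mul t).exp
  have h2 := (hasDerivAt_levelPoly_yuleTree h).mul h1
  have h3 : yuleM' (yuleTree e) t 1 = _ := h2.deriv
  rw [h3, levelPoly_one_yuleTree, show t * (1 - 2 * 1) = -t by ring]
  ring

lemma C_one (n : ℕ) : C n 1 = n + 1 := by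
  induction n with
  | zero => simp [C]
  | succ n ih =>
    rw [C, Finset.prod_range_succ, ← C, ih]
    have : (n : ℝ) + 1 ≠ 0 := by positivity
    field_simp
    push_cast; ring

/-- The logarithmic derivative at `1` is `∑_{k<n} 2/(k+2) = 2 (H_{n+1} - 1)`, and `C_n(1) = n + 1`.
-/
lemma hasDerivAt_C (n : ℕ) :
    HasDerivAt (C n) (2 * (n + 1) * ((harmonic (n + 1) : ℝ) - 1)) 1 := by
  induction n with
  | zero =>
    have : C 0 = fun _ => 1 := by funext z; simp [C]
    rw [this]
    simpa using hasDerivAt_const (1 : ℝ) (1 : ℝ)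
  | succ n ih =>
    have h1 : HasDerivAt (fun z : ℝ => ((n : ℝ) + 2 * z) / ((n : ℝ) + 1)) (2 * 1 / ((n : ℝ) + 1)) 1 :=
      (((hasDerivAt_id (1 : ℝ)).const_mul 2).const_add _).div_const _
    have h2 : C (n + 1) = fun z => C n z * (((n : ℝ) + 2 * z) / ((n : ℝ) + 1)) := by
      funext z; rw [C, Finset.prod_range_succ, ← C]
    rw [h2]
    refine (ih.mul h1).congr_deriv ?_
    rw [C_one, harmonic_succ (n + 1)]
    have h3 : (n : ℝ) + 1 ≠ 0 := by positivity
    have h4 : (n : ℝ) + 1 + 1 ≠ 0 := by positivity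
    push_cast
    field_simp
    ring

/-! ### Jump times -/

/-- Distinct values make the counting function jump by one, at the next value of `D`. The infimum
defining a jump time is therefore attained, over a nonempty set. -/
lemma exists_isLeast_counting {D : Word → ℝ} (hpos : ∀ u, 0 < D u) (hinj : Function.Injective D)
    (hfin : ∀ t, {u | D u ≤ t}.Finite) (n : ℕ) :
    ∃ s, IsLeast {t : ℝ | 0 ≤ t ∧ {u | D u ≤ t}.ncard = n} s := by
  induction n with
  | zero =>
    refine ⟨0, ⟨le_rfl, ?_⟩, fun t ht => ht.1⟩
    rw [Set.ncard_eq_zero (hfin 0)]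
    ext u
    simpa using hpos u
  | succ n ih =>
    obtain ⟨s, ⟨hs0, hs⟩, -⟩ := ih
    obtain ⟨w, hw⟩ : ∃ w, w ∉ {u | D u ≤ s} := (hfin s).exists_notMem
    -- Cutting off at `D w` makes the search for the next value finite.
    obtain ⟨u₀, ⟨hu1, hu2⟩, hmin⟩ :=
      Set.exists_min_image {u | s < D u ∧ D u ≤ D w} D ((hfin (D w)).subset fun u hu => hu.2)
        ⟨w, not_le.1 hw, le_rfl⟩
    have hmin' : ∀ u, s < D u → D u₀ ≤ D u := fun u hu => by
      rcases le_or_gt (D u) (D w) with h | h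
      · exact hmin u ⟨hu, h⟩
      · exact hu2.trans h.le
    refine ⟨D u₀, ⟨(hpos _).le, ?_⟩, fun t ⟨_, ht⟩ => ?_⟩
    · have : {u | D u ≤ D u₀} = insert u₀ {u | D u ≤ s} := by
        ext u
        simp only [Set.mem_ofPred_eq, Set.mem_insert_iff]
        constructor
        · intro h
          rcases le_or_gt (D u) s with h' | h'
          · exact Or.inr h'
          · exact Or.inl (hinj (le_antisymm h (hmin' u h')))
        · rintro (rfl | h)
          · exact le_rfl
          · exact h.trans hu1.le
      rw [this, Set.ncard_insert_of_notMem (s := {u | D u ≤ s}) (not_le.2 hu1) (hfin s), hs]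
    · by_contra hlt
      have hsub : {u | D u ≤ t} ⊆ {u | D u ≤ s} := fun u hu => by
        by_contra h'
        exact hlt ((hmin' u (not_le.1 h')).trans hu)
      have := Set.ncard_le_ncard hsub (hfin s)
      omega

lemma numLeaves_eq_internal {n : ℕ} {e : Env} {t : ℝ} (he : ∀ u, 0 < e u) (ht : 0 ≤ t)
    (h : HeightBound n e t) : numLeaves (yuleTree e) t = 1 + (internalNodes e t).ncard := by
  have h1 : ((internalNodes e t).ncard : ℝ) = internalSum (fun _ => 1) e t := by
    rw [Set.ncard_eq_toFinset_card _ (h.finite_internalNodes he), internalSum,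
      finsum_mem_eq_finite_toFinset_sum _ (h.finite_internalNodes he)]
    simp
  have h2 := popSize_eq_internalSum n e t he ht h
  rw [← numLeaves_eq_popSize h, ← h1] at h2
  exact_mod_cast h2

namespace RegularEnv

variable {W Z : Env → ℝ} {e : Env}

lemma jumpTime_spec (h : RegularEnv W Z e) (n : ℕ) :
    0 ≤ jumpTime (yuleTree e) n ∧ numLeaves (yuleTree e) (jumpTime (yuleTree e) n) = n + 1 := by
  obtain ⟨s, hs⟩ := exists_isLeast_counting (deathTime_pos h.pos) h.injective (fun t => by
    obtain ⟨m, hm⟩ := h.height t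
    exact hm.finite_internalNodes h.pos) n
  have hset : {t : ℝ | 0 ≤ t ∧ numLeaves (yuleTree e) t = n + 1} =
      {t : ℝ | 0 ≤ t ∧ {u | deathTime e u ≤ t}.ncard = n} := by
    ext t
    refine and_congr_right fun ht => ?_
    obtain ⟨m, hm⟩ := h.height t
    rw [numLeaves_eq_internal h.pos ht hm, add_comm, add_left_inj]
    rfl
  rw [← hset] at hs
  have : jumpTime (yuleTree e) n = s := hs.csInf_eq
  rw [this]
  exact hs.1

lemma popSize_jumpTime (h : RegularEnv W Z e) (n : ℕ) :
    popSize e (jumpTime (yuleTree e) n) = n + 1 := by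
  obtain ⟨m, hm⟩ := h.height (jumpTime (yuleTree e) n)
  rw [← numLeaves_eq_popSize hm, (h.jumpTime_spec n).2]
  push_cast; rfl

lemma tendsto_jumpTime (h : RegularEnv W Z e) :
    Tendsto (jumpTime (yuleTree e)) atTop atTop := by
  refine tendsto_atTop.2 fun M => ?_
  filter_upwards [tendsto_natCast_atTop_atTop.eventually_gt_atTop (popSize e (max M 0))] with n hn
  by_contra hlt
  have h1 := popSize_monotoneOn h.pos h.height (h.jumpTime_spec n).1 (le_max_right M 0)
    ((not_le.1 hlt).le.trans (le_max_left M 0))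
  rw [h.popSize_jumpTime] at h1
  linarith

lemma bstM'_one (h : RegularEnv W Z e) (n : ℕ) : bstM' (yuleTree e) n 1 =
    pathLength e (jumpTime (yuleTree e) n) / (n + 1) - 2 * ((harmonic (n + 1) : ℝ) - 1) := by
  obtain ⟨m, hm⟩ := h.height (jumpTime (yuleTree e) n)
  have hC : C n 1 ≠ 0 := by rw [C_one]; positivity
  have h1 := ((hasDerivAt_C n).inv hC).mul (hasDerivAt_levelPoly_yuleTree hm)
  have hfun : (fun x => bstM (yuleTree e) n x) =
      (C n)⁻¹ * fun z => levelPoly (yuleTree e (jumpTime (yuleTree e) n)) z := by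
    funext z
    simp only [bstM, bst, Pi.mul_apply, Pi.inv_apply, one_div]
  rw [bstM', hfun, h1.deriv, levelPoly_one_yuleTree, h.popSize_jumpTime]
  simp only [Pi.inv_apply, C_one]
  have : (n : ℝ) + 1 ≠ 0 := by positivity
  field_simp
  ring

end RegularEnv

/-- The limit of the derivatives of the binary search tree martingale, as a function of the limits
for the Yule tree. -/
noncomputable def bstLimit (W Z : Env → ℝ) (e : Env) : ℝ :=
  Z e / W e - 2 * (Real.log (W e) + Real.eulerMascheroniConstant - 1)

namespace RegularEnv

variable {W Z : Env → ℝ} {e : Env}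

lemma tendsto_numLeaves (h : RegularEnv W Z e) :
    Tendsto (fun t : ℝ => Real.exp (-t) * numLeaves (yuleTree e) t) atTop (𝓝 (W e)) :=
  h.tendsto_popSize.congr fun t => by
    obtain ⟨m, hm⟩ := h.height t
    rw [numLeaves_eq_popSize hm]

lemma tendsto_yuleM' (h : RegularEnv W Z e) :
    Tendsto (fun t : ℝ => yuleM' (yuleTree e) t 1) atTop (𝓝 (Z e)) :=
  h.tendsto_deriv.congr fun t => by
    obtain ⟨m, hm⟩ := h.height t
    rw [yuleM'_one hm]

/-- At `τ_n` the quotient of the two Yule limits gives `P/(n+1) - 2τ_n → Z/W`, and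
`log(e^{-τ_n}(n+1)) → log W` trades `τ_n` for `log(n+1)`. The latter cancels against the harmonic
number up to `γ`. -/
lemma tendsto_bstM' (h : RegularEnv W Z e) :
    Tendsto (fun n : ℕ => bstM' (yuleTree e) n 1) atTop (𝓝 (bstLimit W Z e)) := by
  have hW := h.limit_pos.ne'
  have h1 := h.tendsto_popSize.comp h.tendsto_jumpTime
  have h2 := h.tendsto_deriv.comp h.tendsto_jumpTime
  have h3 := (tendsto_add_atTop_iff_nat 1).2 Real.tendsto_harmonic_sub_log
  have h4 := ((h2.div h1 hW).sub ((h1.log hW).const_mul 2)).sub ((h3.const_mul 2).sub_const 2)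
  have hlim : Z e / W e - 2 * Real.log (W e) - (2 * Real.eulerMascheroniConstant - 2) =
      bstLimit W Z e := by rw [bstLimit]; ring
  rw [hlim] at h4
  refine h4.congr fun n => ?_
  rw [h.bstM'_one]
  have hn : (n : ℝ) + 1 ≠ 0 := by positivity
  simp only [Function.comp_apply, h.popSize_jumpTime, Pi.div_apply]
  rw [Real.log_mul (Real.exp_ne_zero _) hn, Real.log_exp,
    mul_div_mul_left _ _ (Real.exp_ne_zero _), sub_div, mul_div_cancel_right₀ _ hn]
  push_cast
  ring

lemma xi_eq (h : RegularEnv W Z e) : xi (yuleTree e) = W e := h.tendsto_numLeaves.limUnder_eq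

lemma yuleM'Lim_eq (h : RegularEnv W Z e) : yuleM'Lim (yuleTree e) 1 = Z e :=
  h.tendsto_yuleM'.limUnder_eq

lemma bstM'Lim_eq (h : RegularEnv W Z e) : bstM'Lim (yuleTree e) 1 = bstLimit W Z e :=
  h.tendsto_bstM'.limUnder_eq

end RegularEnv

/-! ### Subtrees of the children of the root -/

/-- Both children appear exactly when the root dies; the positive root lifetime makes the constraint
`0 ≤ t` in the infimum harmless. -/
lemma subtree_yuleTree {e : Env} (he : ∀ u, 0 < e u) (i : Bool) :
    subtree (yuleTree e) [i] = yuleTree (e.shift i) := by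
  have h1 : appearTime (yuleTree e) [i] = e [] := by
    have : {t : ℝ | 0 ≤ t ∧ [i] ∈ yuleTree e t} = Set.Ici (e []) := by
      ext t
      simp only [yuleTree, Set.mem_ofPred_eq, birthTime_cons, birthTime_nil, add_zero, Set.mem_Ici,
        and_iff_right_iff_imp]
      exact (he []).le.trans
    rw [appearTime, this, csInf_Ici]
  funext t
  ext v
  simp only [subtree, yuleTree, Set.mem_ofPred_eq, h1, List.singleton_append, birthTime_cons]
  rw [add_comm (e []), add_le_add_iff_right]

/-- The split ratio `W(e⁰) / (W(e⁰) + W(e¹))` at the root. -/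
noncomputable def splitRatio (W : Env → ℝ) (e : Env) : ℝ :=
  W (e.shift false) / (W (e.shift false) + W (e.shift true))

/-- The toll function `2u log u + 2(1-u) log(1-u) + 1` of Quicksort. -/
noncomputable def toll (u : ℝ) : ℝ :=
  2 * u * Real.log u + 2 * (1 - u) * Real.log (1 - u) + 1

/-- Divide the equation of `Z` by that of `W`. The lifetime cancels between `1 - 2r` and `-2 log
W(e)`, the `γ` terms cancel because the split weights sum to one, and `log W(eⁱ) - log(W(e⁰) +
W(e¹))` gives the logarithms in the toll. -/
lemma bstLimit_eq {W Z : Env → ℝ} {e : Env} (h0 : 0 < W (e.shift false))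
    (h1 : 0 < W (e.shift true)) (hW : W e = branch W e)
    (hZ : Z e = weightedBranch (fun r => (1 - 2 * r) * Real.exp (-r)) W e + branch Z e) :
    bstLimit W Z e = splitRatio W e * bstLimit W Z (e.shift false) +
      (1 - splitRatio W e) * bstLimit W Z (e.shift true) + toll (splitRatio W e) := by
  have h2 : 1 - splitRatio W e = W (e.shift true) / (W (e.shift false) + W (e.shift true)) := by
    rw [splitRatio]; field_simp; ring
  have hl0 : Real.log (splitRatio W e) =
      Real.log (W (e.shift false)) - Real.log (W (e.shift false) + W (e.shift true)) := by
    rw [splitRatio, Real.log_div (by positivity) (by positivity)]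
  have hl1 : Real.log (1 - splitRatio W e) =
      Real.log (W (e.shift true)) - Real.log (W (e.shift false) + W (e.shift true)) := by
    rw [h2, Real.log_div (by positivity) (by positivity)]
  have hlW : Real.log (W e) = -e [] + Real.log (W (e.shift false) + W (e.shift true)) := by
    rw [hW, branch_apply, Real.log_mul (Real.exp_ne_zero _) (by positivity), Real.log_exp]
  have hd : Z e / W e = (1 - 2 * e []) + (Z (e.shift false) + Z (e.shift true)) /
      (W (e.shift false) + W (e.shift true)) := by
    rw [hZ, hW, branch_apply, branch_apply, weightedBranch]
    have := Real.exp_ne_zero (-e [])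
    field_simp
  rw [toll, hl0, hl1, bstLimit, bstLimit, bstLimit, hd, hlW, h2, splitRatio]
  field_simp
  ring

/-! ### Independence -/

lemma map_prod_prod_comm {α β γ δ : Type*} [MeasurableSpace α] [MeasurableSpace β]
    [MeasurableSpace γ] [MeasurableSpace δ] (μ : Measure α) (ν : Measure β) (ρ : Measure γ)
    (σ : Measure δ) [SFinite μ] [SFinite ν] [SFinite ρ] [SFinite σ] :
    ((μ.prod ν).prod (ρ.prod σ)).map (fun p => ((p.1.1, p.2.1), (p.1.2, p.2.2))) =
      (μ.prod ρ).prod (ν.prod σ) := by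
  refine Measure.ext_of_lintegral _ fun f hf => ?_
  rw [lintegral_map hf (by fun_prop), lintegral_prod _ (by fun_prop), lintegral_prod _ (by fun_prop),
    lintegral_prod _ (by fun_prop), lintegral_prod _ (by fun_prop)]
  refine lintegral_congr fun a => ?_
  have h1 : ∀ b, ∫⁻ y : γ × δ, f ((a, y.1), (b, y.2)) ∂(ρ.prod σ) =
      ∫⁻ c, ∫⁻ d, f ((a, c), (b, d)) ∂σ ∂ρ := fun b => lintegral_prod _ (by fun_prop)
  have h2 : ∀ c, ∫⁻ y : β × δ, f ((a, c), y) ∂(ν.prod σ) =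
      ∫⁻ b, ∫⁻ d, f ((a, c), (b, d)) ∂σ ∂ν := fun c => lintegral_prod _ (by fun_prop)
  simp only [h1, h2]
  refine lintegral_lintegral_swap ?_
  exact (Measurable.lintegral_prod_right'
    (f := fun q : (β × γ) × δ => f ((a, q.1.2), (q.1.1, q.2))) (by fun_prop)).aemeasurable

@[fun_prop]
lemma measurable_splitRatio {W : Env → ℝ} (hW : Measurable W) : Measurable (splitRatio W) := by
  unfold splitRatio; fun_prop

@[fun_prop]
lemma measurable_toll : Measurable toll := by
  unfold toll; fun_prop

/-- If `F` is independent of the `Exp(1)` variable `W`, then `branch W`, the split ratio at the root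
and the two copies of `F` on the subtrees are independent. -/
lemma map_branch_splitRatio_copies {W F : Env → ℝ} (hW : Measurable W)
    (hWmap : envMeasure.map W = expMeasure 1) (hF : Measurable F)
    (hind : IndepFun W F envMeasure) :
    envMeasure.map (fun e => (branch W e, splitRatio W e, F (e.shift false), F (e.shift true))) =
      (expMeasure 1).prod (unifMeasure.prod ((envMeasure.map F).prod (envMeasure.map F))) := by
  have hν : IsProbabilityMeasure (envMeasure.map F) := Measure.isProbabilityMeasure_map hF.aemeasurable
  set ν := envMeasure.map F
  have h1 := map_split_pair (F := fun e => (W e, F e)) (hW.prodMk hF)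
  rw [(indepFun_iff_map_prod_eq_prod_map_map hW.aemeasurable hF.aemeasurable).1 hind, hWmap] at h1
  have h2 : envMeasure.map (fun e : Env => ((e [], W (e.shift false), W (e.shift true)),
      (F (e.shift false), F (e.shift true)))) =
      ((expMeasure 1).prod ((expMeasure 1).prod (expMeasure 1))).prod (ν.prod ν) := by
    rw [← (measurePreserving_prodAssoc (expMeasure 1) ((expMeasure 1).prod (expMeasure 1))
      (ν.prod ν)).symm.map_eq, ← map_prod_prod_comm (expMeasure 1) ν (expMeasure 1) ν]
    have h0 := Measure.map_prod_map (expMeasure 1)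
      (((expMeasure 1).prod ν).prod ((expMeasure 1).prod ν)) measurable_id
      (g := fun p : (ℝ × ℝ) × ℝ × ℝ => ((p.1.1, p.2.1), (p.1.2, p.2.2))) (by fun_prop)
    rw [Measure.map_id] at h0
    rw [h0, ← h1,
      Measure.map_map (by fun_prop) (by fun_prop), Measure.map_map (by fun_prop) (by fun_prop)]
    rfl
  rw [← (measurePreserving_prodAssoc (expMeasure 1) unifMeasure (ν.prod ν)).map_eq,
    ← map_exp_mul_sum_ratio]
  conv_rhs => rw [← Measure.map_id (μ := ν.prod ν)]
  rw [Measure.map_prod_map _ _ (by fun_prop) measurable_id, ← h2,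
    Measure.map_map (by fun_prop) (by fun_prop), Measure.map_map (by fun_prop) (by fun_prop)]
  rfl

lemma indepFun_of_map_prod {Ω β γ : Type*} [MeasurableSpace Ω] [MeasurableSpace β]
    [MeasurableSpace γ] {μ : Measure Ω} [IsProbabilityMeasure μ] {X : Ω → β} {Y : Ω → γ}
    (hX : AEMeasurable X μ) (hY : AEMeasurable Y μ) {ρ : Measure β} {σ : Measure γ}
    [IsProbabilityMeasure ρ] [IsProbabilityMeasure σ]
    (h : μ.map (fun ω => (X ω, Y ω)) = ρ.prod σ) : IndepFun X Y μ := by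
  rw [indepFun_iff_map_prod_eq_prod_map_map hX hY, h]
  have h1 := congrArg (Measure.map Prod.fst) h
  have h2 := congrArg (Measure.map Prod.snd) h
  rw [AEMeasurable.map_map_of_aemeasurable (by fun_prop) (hX.prodMk hY), Measure.map_fst_prod,
    measure_univ, one_smul] at h1
  rw [AEMeasurable.map_map_of_aemeasurable (by fun_prop) (hX.prodMk hY), Measure.map_snd_prod,
    measure_univ, one_smul] at h2
  rw [← h1, ← h2]
  rfl

lemma indepFun_of_ae_tendsto {Ω : Type*} [MeasurableSpace Ω] {μ : Measure Ω}
    [IsProbabilityMeasure μ] {X Y : Ω → ℝ} {f : ℕ → Ω → ℝ} (hX : Measurable X) (hY : Measurable Y)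
    (hf : ∀ n, Measurable (f n)) (hind : ∀ n, IndepFun X (f n) μ)
    (h : ∀ᵐ ω ∂μ, Tendsto (fun n => f n ω) atTop (𝓝 (Y ω))) : IndepFun X Y μ := by
  refine indepFun_of_bcf hX.aemeasurable hY.aemeasurable fun φ ψ => ?_
  have hm : ∀ n, Measurable fun ω => ψ (f n ω) := fun n => ψ.continuous.measurable.comp (hf n)
  have hφ : Measurable fun ω => φ (X ω) := φ.continuous.measurable.comp hX
  have h1 : Tendsto (fun n => ∫ ω, ψ (f n ω) ∂μ) atTop (𝓝 (∫ ω, ψ (Y ω) ∂μ)) := by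
    refine tendsto_integral_of_dominated_convergence (fun _ => ‖ψ‖)
      (fun n => (hm n).aestronglyMeasurable) (integrable_const _)
      (fun n => ae_of_all _ fun x => ψ.norm_coe_le_norm _) ?_
    filter_upwards [h] with x hx
    exact (ψ.continuous.tendsto _).comp hx
  have h2 : Tendsto (fun n => ∫ ω, φ (X ω) * ψ (f n ω) ∂μ) atTop
      (𝓝 (∫ ω, φ (X ω) * ψ (Y ω) ∂μ)) := by
    refine tendsto_integral_of_dominated_convergence (fun _ => ‖φ‖ * ‖ψ‖)
      (fun n => (hφ.mul (hm n)).aestronglyMeasurable) (integrable_const _)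
      (fun n => ae_of_all _ fun x => ?_) ?_
    · rw [norm_mul]
      exact mul_le_mul (φ.norm_coe_le_norm _) (ψ.norm_coe_le_norm _) (norm_nonneg _) (norm_nonneg _)
    · filter_upwards [h] with x hx
      exact ((ψ.continuous.tendsto _).comp hx).const_mul _
  have h3 : ∀ n, ∫ ω, φ (X ω) * ψ (f n ω) ∂μ = (∫ ω, φ (X ω) ∂μ) * ∫ ω, ψ (f n ω) ∂μ := fun n =>
    ((hind n).comp φ.continuous.measurable ψ.continuous.measurable).integral_fun_mul_eq_mul_integral
      hφ.aestronglyMeasurable (hm n).aestronglyMeasurable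
  simp only [h3] at h2
  exact tendsto_nhds_unique h2 (h1.const_mul _)

/-- Approximations of the Quicksort limit, obtained by unfolding the Quicksort recursion `n` times
and starting from a constant. -/
noncomputable def quicksortApprox (W : Env → ℝ) (m : ℝ) : ℕ → Env → ℝ
  | 0 => fun _ => m
  | n + 1 => fun e => splitRatio W e * quicksortApprox W m n (e.shift false) +
      (1 - splitRatio W e) * quicksortApprox W m n (e.shift true) + toll (splitRatio W e)

lemma measurable_quicksortApprox {W : Env → ℝ} (hW : Measurable W) (m : ℝ) (n : ℕ) :
    Measurable (quicksortApprox W m n) := by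
  induction n with
  | zero => exact measurable_const
  | succ n ih => simp only [quicksortApprox]; fun_prop

/-- The next approximation depends only on the split ratio and on two copies of the previous one. By
induction and beta-gamma algebra these are jointly independent of `branch W`, which is `W` almost
surely. -/
lemma indepFun_quicksortApprox {W : Env → ℝ} (hW : Measurable W)
    (hWmap : envMeasure.map W = expMeasure 1) (hfix : ∀ᵐ e ∂envMeasure, W e = branch W e) (m : ℝ)
    (n : ℕ) : IndepFun W (quicksortApprox W m n) envMeasure := by
  induction n with
  | zero => exact indepFun_const_right W m
  | succ n ih =>
    have hm := measurable_quicksortApprox hW m n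
    have h1 := map_branch_splitRatio_copies hW hWmap hm ih
    have : IsProbabilityMeasure (envMeasure.map (quicksortApprox W m n)) :=
      Measure.isProbabilityMeasure_map hm.aemeasurable
    have h2 := indepFun_of_map_prod (X := branch W) (Y := fun e => (splitRatio W e,
      quicksortApprox W m n (e.shift false), quicksortApprox W m n (e.shift true)))
      (by fun_prop) (by fun_prop) h1
    have h3 := h2.comp measurable_id
      (ψ := fun q : ℝ × ℝ × ℝ => q.1 * q.2.1 + (1 - q.1) * q.2.2 + toll q.1) (by fun_prop)
    exact h3.congr (by filter_upwards [hfix] with e he using he.symm) (ae_of_all _ fun _ => rfl)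

lemma measurable_bstLimit {W Z : Env → ℝ} (hW : Measurable W) (hZ : Measurable Z) :
    Measurable (bstLimit W Z) := by
  unfold bstLimit; fun_prop

/-- The errors of the Quicksort approximations, weighted by `W`, evolve exactly by `branch`, so they
vanish almost surely in the limit. Independence from `W` then passes to that limit. -/
theorem indepFun_bstLimit {W Z : Env → ℝ} (hW : Measurable W)
    (hWmap : envMeasure.map W = expMeasure 1) (hfix : ∀ᵐ e ∂envMeasure, W e = branch W e)
    (hZ : Measurable Z) (hZL : MemLp Z 2 envMeasure) (hZfix : ∀ᵐ e ∂envMeasure,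
      Z e = weightedBranch (fun r => (1 - 2 * r) * Real.exp (-r)) W e + branch Z e) :
    IndepFun W (bstLimit W Z) envMeasure := by
  have hQ := measurable_bstLimit hW hZ
  have hWL : MemLp W 2 envMeasure := memLp_comp_of_map_eq hW hWmap memLp_id_expMeasure
  have hW1 : ∫ e, W e ∂envMeasure = 1 := by
    rw [← integral_id_expMeasure, ← hWmap, integral_map hW.aemeasurable (by fun_prop)]
  have hWpos : ∀ᵐ e ∂envMeasure, 0 < W e :=
    (MeasurePreserving.mk hW hWmap).quasiMeasurePreserving.ae ae_pos_expMeasure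
  have hWlog : MemLp (fun e => W e * Real.log (W e)) 2 envMeasure :=
    memLp_comp_of_map_eq hW hWmap memLp_mul_log_expMeasure
  have hWQ : MemLp (fun e => W e * bstLimit W Z e) 2 envMeasure := by
    have h : MemLp (fun e => Z e - (2 * (W e * Real.log (W e)) +
        2 * (Real.eulerMascheroniConstant - 1) * W e)) 2 envMeasure :=
      hZL.sub ((hWlog.const_mul 2).add (hWL.const_mul _))
    refine h.ae_eq ?_
    filter_upwards [hWpos] with e he
    rw [bstLimit]
    field_simp
    ring
  -- Starting the approximations from this `W`-weighted mean makes `W (Q - m)` centred, as `E[W] =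
  -- 1`.
  set m := ∫ e, W e * bstLimit W Z e ∂envMeasure with hm
  let D : Env → ℝ := fun e => W e * (bstLimit W Z e - m)
  have hD : Measurable D := by fun_prop
  have hDeq : D = fun e => W e * bstLimit W Z e - m * W e := by funext e; simp only [D]; ring
  have hDL : MemLp D 2 envMeasure := by rw [hDeq]; exact hWQ.sub (hWL.const_mul m)
  have hD0 : ∫ e, D e ∂envMeasure = 0 := by
    rw [hDeq, integral_sub (hWQ.integrable (by norm_num)) ((hWL.const_mul m).integrable
      (by norm_num)), integral_const_mul, hW1, ← hm]
    ring
  have hstep : ∀ n, ∀ᵐ e ∂envMeasure,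
      W e * (bstLimit W Z e - quicksortApprox W m n e) = branch^[n] D e := by
    intro n
    induction n with
    | zero => exact ae_of_all _ fun _ => rfl
    | succ n ih =>
      filter_upwards [hfix, hZfix, ae_shift ih false, ae_shift ih true, ae_shift hWpos false,
        ae_shift hWpos true] with e h1 h2 h3 h4 h5 h6
      have hs : splitRatio W e * (W (e.shift false) + W (e.shift true)) = W (e.shift false) :=
        div_mul_cancel₀ _ (by positivity)
      rw [Function.iterate_succ_apply', branch_apply, ← h3, ← h4, bstLimit_eq h5 h6 h1 h2,
        quicksortApprox, h1, branch_apply]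
      -- The tolls cancel in the difference, and multiplying the split weights by `W(e)` gives
      -- `e^{-r} W(e⁰)` and `e^{-r} W(e¹)`.
      linear_combination Real.exp (-e []) * ((bstLimit W Z (e.shift false) -
        quicksortApprox W m n (e.shift false)) - (bstLimit W Z (e.shift true) -
        quicksortApprox W m n (e.shift true))) * hs
  refine indepFun_of_ae_tendsto hW hQ (measurable_quicksortApprox hW m)
    (indepFun_quicksortApprox hW hWmap hfix m) ?_
  filter_upwards [ae_all_iff.2 hstep, (iterate_branch_summable hD hDL hD0).1, hWpos] with e h1 h2 h3
  have h4 : Tendsto (fun n => branch^[n] D e) atTop (𝓝 0) :=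
    (tendsto_zero_iff_abs_tendsto_zero _).2 h2.tendsto_atTop_zero
  have h5 := (h4.const_mul (W e)⁻¹).const_sub (bstLimit W Z e)
  simp only [← h1, mul_zero, sub_zero] at h5
  refine h5.congr fun n => ?_
  rw [inv_mul_cancel_left₀ h3.ne']
  ring

lemma iIndepFun_of_map_prod {Ω : Type*} [MeasurableSpace Ω] {μ : Measure Ω}
    [IsProbabilityMeasure μ] {X Y V : Ω → ℝ} (hX : AEMeasurable X μ) (hY : AEMeasurable Y μ)
    (hV : AEMeasurable V μ) {a b c : Measure ℝ} [IsProbabilityMeasure a] [IsProbabilityMeasure b]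
    [IsProbabilityMeasure c] (h : μ.map (fun ω => (X ω, Y ω, V ω)) = a.prod (b.prod c)) :
    iIndepFun ![X, Y, V] μ := by
  have hm : AEMeasurable (fun ω => (X ω, Y ω, V ω)) μ := hX.prodMk (hY.prodMk hV)
  have ha : μ.map X = a := by
    have h1 := congrArg (Measure.map Prod.fst) h
    rwa [AEMeasurable.map_map_of_aemeasurable (by fun_prop) hm, Measure.map_fst_prod,
      measure_univ, one_smul] at h1
  have hbc : μ.map (fun ω => (Y ω, V ω)) = b.prod c := by
    have h1 := congrArg (Measure.map Prod.snd) h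
    rwa [AEMeasurable.map_map_of_aemeasurable (by fun_prop) hm, Measure.map_snd_prod,
      measure_univ, one_smul] at h1
  have hb : μ.map Y = b := by
    have h1 := congrArg (Measure.map Prod.fst) hbc
    rwa [AEMeasurable.map_map_of_aemeasurable (by fun_prop) (hY.prodMk hV), Measure.map_fst_prod,
      measure_univ, one_smul] at h1
  have hc : μ.map V = c := by
    have h1 := congrArg (Measure.map Prod.snd) hbc
    rwa [AEMeasurable.map_map_of_aemeasurable (by fun_prop) (hY.prodMk hV), Measure.map_snd_prod,
      measure_univ, one_smul] at h1
  have hall : ∀ i, AEMeasurable (![X, Y, V] i) μ := by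
    intro i; fin_cases i <;> assumption
  rw [iIndepFun_iff_map_fun_eq_pi_map hall]
  have (i : Fin 3) : IsProbabilityMeasure (μ.map (![X, Y, V] i)) :=
    Measure.isProbabilityMeasure_map (hall i)
  refine (Measure.pi_eq fun s hs => ?_).symm
  rw [Measure.map_apply_of_aemeasurable (aemeasurable_pi_lambda _ hall) (.univ_pi hs)]
  have hset : (fun ω i => ![X, Y, V] i ω) ⁻¹' (Set.univ.pi s) =
      (fun ω => (X ω, Y ω, V ω)) ⁻¹' (s 0 ×ˢ (s 1 ×ˢ s 2)) := by
    ext ω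
    simp [Set.mem_pi, Fin.forall_fin_succ]
  rw [hset, ← Measure.map_apply_of_aemeasurable hm ((hs 0).prod ((hs 1).prod (hs 2))), h,
    Measure.prod_prod, Measure.prod_prod, Fin.prod_univ_three]
  simp [ha, hb, hc, mul_assoc]

end

/-! ### The main theorem -/

lemma measurePreserving_of_isExpLifetimes {Ω : Type*} [MeasurableSpace Ω] {μ : Measure Ω}
    {e : Word → Ω → ℝ} (he : IsExpLifetimes μ e) :
    MeasurePreserving (fun ω u => e u ω) μ envMeasure := by
  have hm : Measurable fun ω u => e u ω := measurable_pi_lambda _ he.measurable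
  exact ⟨hm, (he.indep.hasLaw_infinitePi he.law hm.aemeasurable).map_eq⟩

theorem corollary3p6 {Ω : Type*} [MeasurableSpace Ω] (μ : Measure Ω) [IsProbabilityMeasure μ]
    (e : Word → Ω → ℝ) (he : IsExpLifetimes μ e)
    (T : Ω → ℝ → Set Word) (hT : ∀ ω t, T ω t = yuleTree (fun u => e u ω) t) :
    -- existence of the almost sure limits that occur below, and the law of `ξ`
    ((∀ᵐ ω ∂μ, Tendsto (fun t : ℝ => Real.exp (-t) * numLeaves (T ω) t) atTop (𝓝 (xi (T ω)))) ∧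
      HasLaw (fun ω => xi (T ω)) (expMeasure 1) μ ∧
      (∀ i : Bool, ∀ᵐ ω ∂μ,
        Tendsto (fun t : ℝ => Real.exp (-t) * numLeaves (subtree (T ω) [i]) t) atTop
          (𝓝 (xi (subtree (T ω) [i])))) ∧
      (∀ᵐ ω ∂μ, Tendsto (fun t : ℝ => yuleM' (T ω) t 1) atTop (𝓝 (yuleM'Lim (T ω) 1))) ∧
      (∀ᵐ ω ∂μ, Tendsto (fun n : ℕ => bstM' (T ω) n 1) atTop (𝓝 (bstM'Lim (T ω) 1))) ∧
      (∀ i : Bool, ∀ᵐ ω ∂μ,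
        Tendsto (fun n : ℕ => bstM' (subtree (T ω) [i]) n 1) atTop
          (𝓝 (bstM'Lim (subtree (T ω) [i]) 1)))) ∧
    -- the connection between the two limits
    (∀ᵐ ω ∂μ, yuleM'Lim (T ω) 1 =
      xi (T ω) *
        (bstM'Lim (T ω) 1 + 2 * (Real.log (xi (T ω)) + Real.eulerMascheroniConstant - 1))) ∧
    -- the almost sure Quicksort equation
    (∀ᵐ ω ∂μ, bstM'Lim (T ω) 1 =
      U (T ω) * bstM'Lim (subtree (T ω) [false]) 1
        + (1 - U (T ω)) * bstM'Lim (subtree (T ω) [true]) 1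
        + 2 * U (T ω) * Real.log (U (T ω))
        + 2 * (1 - U (T ω)) * Real.log (1 - U (T ω)) + 1) ∧
    -- the joint law of the random variables on its right-hand side
    HasLaw (fun ω => U (T ω)) (volume.restrict (Set.Icc (0 : ℝ) 1)) μ ∧
    (∀ i : Bool, IdentDistrib (fun ω => bstM'Lim (subtree (T ω) [i]) 1)
      (fun ω => bstM'Lim (T ω) 1) μ μ) ∧
    iIndepFun ![fun ω => U (T ω), fun ω => bstM'Lim (subtree (T ω) [false]) 1,
      fun ω => bstM'Lim (subtree (T ω) [true]) 1] μ := by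
  obtain ⟨W, hW, hWmap, hWfix⟩ := exists_population_limit
  obtain ⟨Z, hZ, hZL, hZ0, hZfix⟩ := exists_derivative_limit hW hWmap
  set E : Ω → Env := fun ω u => e u ω
  have hE : MeasurePreserving E μ envMeasure := measurePreserving_of_isExpLifetimes he
  obtain rfl : T = fun ω => yuleTree (E ω) := funext fun ω => funext fun t => hT ω t
  have hreg := ae_regularEnv hW hWmap hWfix hZ hZL hZ0 hZfix
  have r0 : ∀ᵐ ω ∂μ, RegularEnv W Z (E ω) := hE.quasiMeasurePreserving.ae hreg
  have r1 : ∀ i, ∀ᵐ ω ∂μ, RegularEnv W Z ((E ω).shift i) := fun i =>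
    hE.quasiMeasurePreserving.ae (ae_shift hreg i)
  have s1 : ∀ i, ∀ᵐ ω ∂μ, subtree (yuleTree (E ω)) [i] = yuleTree ((E ω).shift i) := fun i => by
    filter_upwards [r0] with ω h using subtree_yuleTree h.pos i
  have w0 : ∀ᵐ ω ∂μ, W (E ω) = branch W (E ω) := hE.quasiMeasurePreserving.ae hWfix
  have z0 : ∀ᵐ ω ∂μ, Z (E ω) = weightedBranch (fun r => (1 - 2 * r) * Real.exp (-r)) W (E ω) +
      branch Z (E ω) := hE.quasiMeasurePreserving.ae hZfix
  have hUeq : (fun ω => U (yuleTree (E ω))) =ᵐ[μ] fun ω => splitRatio W (E ω) := by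
    filter_upwards [r1 false, r1 true, s1 false, s1 true] with ω h1 h2 h3 h4
    rw [U, h3, h4, h1.xi_eq, h2.xi_eq, splitRatio]
  have hQ := measurable_bstLimit hW hZ
  have hQeq : (fun ω => bstM'Lim (yuleTree (E ω)) 1) =ᵐ[μ] fun ω => bstLimit W Z (E ω) := by
    filter_upwards [r0] with ω h using h.bstM'Lim_eq
  have hQieq : ∀ i, (fun ω => bstM'Lim (subtree (yuleTree (E ω)) [i]) 1) =ᵐ[μ]
      fun ω => bstLimit W Z ((E ω).shift i) := fun i => by
    filter_upwards [r1 i, s1 i] with ω h1 h2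
    rw [h2, h1.bstM'Lim_eq]
  -- Applied to `F = bstLimit W Z`, this gives the required joint law once the first coordinate is
  -- dropped.
  have hlaw := map_branch_splitRatio_copies hW hWmap hQ
    (indepFun_bstLimit hW hWmap hWfix hZ hZL hZfix)
  have hν : IsProbabilityMeasure (envMeasure.map (bstLimit W Z)) :=
    Measure.isProbabilityMeasure_map hQ.aemeasurable
  have hlaw3 : μ.map (fun ω => (splitRatio W (E ω), bstLimit W Z ((E ω).shift false),
      bstLimit W Z ((E ω).shift true))) = unifMeasure.prod
        ((envMeasure.map (bstLimit W Z)).prod (envMeasure.map (bstLimit W Z))) := by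
    have h := congrArg (Measure.map Prod.snd) hlaw
    rw [Measure.map_map (by fun_prop) (by fun_prop), Measure.map_snd_prod, measure_univ, one_smul,
      ← hE.map_eq, Measure.map_map (by fun_prop) hE.measurable] at h
    exact h.trans (by rw [hE.map_eq])
  have hEm := hE.measurable
  refine ⟨⟨?_, ?_, ?_, ?_, ?_, ?_⟩, ?_, ?_, ?_, ?_, ?_⟩
  · filter_upwards [r0] with ω h
    rw [h.xi_eq]; exact h.tendsto_numLeaves
  · have h : HasLaw (fun ω => W (E ω)) (expMeasure 1) μ :=
      ((MeasurePreserving.mk hW hWmap).comp hE).hasLaw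
    exact h.congr (by filter_upwards [r0] with ω h using h.xi_eq)
  · intro i
    filter_upwards [r1 i, s1 i] with ω h1 h2
    rw [h2, h1.xi_eq]; exact h1.tendsto_numLeaves
  · filter_upwards [r0] with ω h
    rw [h.yuleM'Lim_eq]; exact h.tendsto_yuleM'
  · filter_upwards [r0] with ω h
    rw [h.bstM'Lim_eq]; exact h.tendsto_bstM'
  · intro i
    filter_upwards [r1 i, s1 i] with ω h1 h2
    rw [h2, h1.bstM'Lim_eq]; exact h1.tendsto_bstM'
  · filter_upwards [r0] with ω h
    rw [h.yuleM'Lim_eq, h.xi_eq, h.bstM'Lim_eq, bstLimit]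
    field_simp [h.limit_pos.ne']
    ring
  · filter_upwards [r1 false, r1 true, w0, z0, hUeq, hQeq, hQieq false, hQieq true]
      with ω h1 h2 h3 h4 h5 h6 h7 h8
    rw [h5, h6, h7, h8, bstLimit_eq h1.limit_pos h2.limit_pos h3 h4, toll]
    ring
  · have hs : HasLaw (fun ω => splitRatio W (E ω)) unifMeasure μ := by
      refine ⟨by fun_prop, ?_⟩
      have h := congrArg (Measure.map Prod.fst) hlaw3
      rw [Measure.map_map (by fun_prop) (by fun_prop), Measure.map_fst_prod, measure_univ,
        one_smul] at h
      exact h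
    exact hs.congr hUeq
  · intro i
    have hm : Measurable fun ω => bstLimit W Z (E ω) := hQ.comp hEm
    have hmi : Measurable fun ω => bstLimit W Z ((E ω).shift i) :=
      hQ.comp ((Env.measurable_shift i).comp hEm)
    refine ⟨hmi.aemeasurable.congr (hQieq i).symm, hm.aemeasurable.congr hQeq.symm, ?_⟩
    rw [Measure.map_congr (hQieq i), Measure.map_congr hQeq]
    have h1 := (((MeasurePreserving.mk hQ rfl).comp (measurePreserving_shift i)).comp hE).map_eq
    have h2 := ((MeasurePreserving.mk hQ rfl).comp hE).map_eq
    exact h1.trans h2.symm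
  · have h := iIndepFun_of_map_prod (by fun_prop) (by fun_prop) (by fun_prop) hlaw3
    refine h.congr fun i => ?_
    fin_cases i
    · exact hUeq.symm
    · exact (hQieq false).symm
    · exact (hQieq true).symm
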